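/- Let $k$ be an algebraically closed field of characteristic $0$, let $X$ be a smooth projective threefold over $k$, and let $R$ be a discrete valuation ring that is a $k$-algebra, with uniformiser $\pi$. For $m\ge 1$ put $X_m := X\otimes_k R/\pi^m$, and for $1\le m'<m$ let $\iota=\iota_{m,m'}\colon X_{m'}\hookrightarrow X_m$ be the closed immersion induced by $R/\pi^m\to R/\pi^{m'}$. For $Y=X_{m'}$, let $D(Y)$ be the derived category of complexes of $\mathcal O_Y$-modules with coherent cohomology sheaves. Let $\mathrm{Coh}_{\le 1}(Y)$ be the category of coherent sheaves on $Y$ whose support has dimension at most $1$, and let $\mathrm{Coh}_{\ge 2}(Y)$ be the category of coherent sheaves that receive no nonzero morphism from an object of $\mathrm{Coh}_{\le 1}(Y)$. Consider the t-structure on $D(Y)$ obtained by tilting at the torsion pair $(\mathrm{Coh}_{\le 1}(Y),\mathrm{Coh}_{\ge 2}(Y))$, that is, $$D^{\le 0}=\{E : H^0(E)\in\mathrm{Coh}_{\le 1}(Y),\ H^i(E)=0 \text{ for } i>0\},$$ $$D^{\ge 0}=\{E : H^{-1}(E)\in\mathrm{Coh}_{\ge 2}(Y),\ H^i(E)=0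 \text{ for } i<-1\}.$$ Let $\mathcal A^p_{m'}=D^{\le 0}\cap D^{\ge 0}=\langle \mathrm{Coh}_{\le 1}(X_{m'}),\mathrm{Coh}_{\ge 2}(X_{m'})[1]\rangle$ be its heart, and let $\mathcal H^i_{\mathcal A^p_{m'}}$ ($i\in\mathbb Z$) be its cohomology functors: $\mathcal H^i_{\mathcal A^p_{m'}}(E)[-i]\cong\tau^{\ge i}\tau^{\le i}E$, with $\tau$ the truncations of this t-structure. Let $1\le m'<m$ and let $A\in\mathcal A^p_{m'}$. Let $\iota_*$ be the (exact) pushforward, applied termwise to complexes, and let $L\iota^*$ be the left derived pullback. Then all the objects $\mathcal H^i_{\mathcal A^p_{m'}}(L\iota^*\iota_*A)$ with $i<0$ odd are isomorphic: for all odd integers $i,j<0$, $$\mathcal H^i_{\mathcal A^p_{m'}}(L\iota^*\iota_*A)\;\cong\;\mathcal H^j_{\mathcal A^p_{m'}}(L\iota^*\iota_*A).$$ -/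

import Mathlib

open CategoryTheory Limits AlgebraicGeometry

universe w w' u

namespace CoherentTilt

/-- An epimorphism of sheaves of modules is an epimorphism of the underlying abelian sheaves. -/
theorem preservesEpimorphisms_toSheaf {C : Type u} [Category.{u} C]
    {J : GrothendieckTopology C} (R : Sheaf J RingCat.{u}) [HasSheafify J AddCommGrpCat.{u}]
    [J.WEqualsLocallyBijective AddCommGrpCat.{u}] :
    (SheafOfModules.toSheaf.{u} R).PreservesEpimorphisms where
  preserves {M N} φ hφ := by
    let a : PresheafOfModules.{u} R.obj ⥤ SheafOfModules.{u} R :=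
      PresheafOfModules.sheafification (𝟙 R.obj)
    let adj : a ⊣ _ := PresheafOfModules.sheafificationAdjunction (𝟙 R.obj)
    have : IsIso adj.counit :=
      inferInstanceAs (IsIso (PresheafOfModules.sheafificationAdjunction (𝟙 R.obj)).counit)
    have : a.IsLeftAdjoint := adj.isLeftAdjoint
    have : a.PreservesZeroMorphisms := Functor.preservesZeroMorphisms_of_isLeftAdjoint a
    let ψ : M.val ⟶ N.val := φ.val
    let c : N.val ⟶ cokernel ψ := cokernel.π ψ
    have key (P : SheafOfModules.{u} R) : IsIso (adj.counit.app P) := inferInstance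
    let eM : a.obj M.val ≅ M := @asIso _ _ _ _ (adj.counit.app M) (key M)
    let eN : a.obj N.val ≅ N := @asIso _ _ _ _ (adj.counit.app N) (key N)
    have hψ : a.map ψ ≫ eN.hom = eM.hom ≫ φ := adj.counit.naturality φ
    have h0 : a.map ψ = eM.hom ≫ φ ≫ eN.inv := by
      rw [← Category.assoc, ← hψ, Category.assoc, eN.hom_inv_id, Category.comp_id]
    have h1 : Epi (a.map ψ) := by rw [h0]; infer_instance
    have h2 : a.map c = 0 := by
      rw [← cancel_epi (a.map ψ), ← a.map_comp, cokernel.condition, a.map_zero, comp_zero]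
    let G := PresheafOfModules.toPresheaf R.obj ⋙ presheafToSheaf J AddCommGrpCat.{u}
    have : PreservesFiniteColimits G := comp_preservesFiniteColimits _ _
    have : G.PreservesZeroMorphisms :=
      inferInstance
    have h3 : G.map c = 0 := by
      have := congr_arg (SheafOfModules.toSheaf R).map h2
      rw [Functor.map_zero] at this
      exact this
    have hex : (ShortComplex.mk (G.map ψ) (G.map c)
        (by rw [← G.map_comp, cokernel.condition, G.map_zero])).Exact :=
      ShortComplex.exact_of_g_is_cokernel _
        (CokernelCofork.mapIsColimit _ (cokernelIsCokernel ψ) G)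
    have h4 : Epi (G.map ψ) := hex.epi_f h3
    have h4' : Epi ((SheafOfModules.toSheaf R).map (a.map ψ)) := h4
    have h5 : φ = eM.inv ≫ a.map ψ ≫ eN.hom := by simp [hψ]
    rw [h5, Functor.map_comp, Functor.map_comp]
    infer_instance

/-- The underlying abelian sheaf of an `𝒪_Y`-module. -/
noncomputable def toAbSheaf (Y : Scheme.{u}) : Y.Modules ⥤ TopCat.Sheaf AddCommGrpCat.{u} Y :=
  SheafOfModules.toSheaf.{u} Y.ringCatSheaf

/-- A morphism of `𝒪_Y`-modules is an epimorphism iff it is locally surjective. -/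
theorem epi_iff_locallySurjective {Y : Scheme.{u}} {M N : Y.Modules} (φ : M ⟶ N) :
    Epi φ ↔ TopCat.Presheaf.IsLocallySurjective φ.mapPresheaf := by
  have h : TopCat.Presheaf.IsLocallySurjective φ.mapPresheaf ↔ Epi ((toAbSheaf Y).map φ) :=
    TopCat.Sheaf.isLocallySurjective_iff_epi ((toAbSheaf Y).map φ)
  rw [h]
  have : (toAbSheaf Y).PreservesEpimorphisms :=
    preservesEpimorphisms_toSheaf Y.ringCatSheaf
  have : (toAbSheaf Y).Faithful :=
    inferInstanceAs (SheafOfModules.toSheaf.{u} Y.ringCatSheaf).Faithful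
  exact ⟨fun _ => inferInstance, fun h => (toAbSheaf Y).epi_of_epi_map h⟩

/-- Pushforward along a closed immersion preserves epimorphisms. -/
instance {Y Z : Scheme.{u}} (f : Y ⟶ Z) [IsClosedImmersion f] :
    (Scheme.Modules.pushforward f).PreservesEpimorphisms where
  preserves {M N} φ hφ := by
    rw [epi_iff_locallySurjective, TopCat.Presheaf.isLocallySurjective_iff] at *
    intro U t x hx
    by_cases hxf : x ∈ Set.range f
    · obtain ⟨y, rfl⟩ := hxf
      obtain ⟨V, hV, ⟨s, hs⟩, hyV⟩ := hφ (f ⁻¹ᵁ U) t y hx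
      obtain ⟨W, hW, hWV⟩ := f.isClosedEmbedding.isInducing.isOpen_iff.mp V.isOpen
      let W' : Z.Opens := ⟨W, hW⟩ ⊓ U
      have hW' : f ⁻¹ᵁ W' ≤ V := fun z hz => by
        have : z ∈ f ⁻¹' W := hz.1
        rw [hWV] at this
        exact this
      refine ⟨W', inf_le_right, ⟨M.presheaf.map (homOfLE hW').op s, ?_⟩, ⟨?_, hx⟩⟩
      · change φ.app (f ⁻¹ᵁ W') _ = N.presheaf.map (homOfLE (f.preimage_mono inf_le_right)).op t
        change φ.app V s = N.presheaf.map (homOfLE hV).op t at hs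
        have h1 := ConcreteCategory.congr_hom (φ.mapPresheaf.naturality (homOfLE hW').op) s
        have h2 : N.presheaf.map (homOfLE hW').op (φ.app V s) =
            N.presheaf.map (homOfLE (f.preimage_mono inf_le_right)).op t := by
          rw [hs]
          exact (ConcreteCategory.congr_hom
            (N.presheaf.map_comp (homOfLE hV).op (homOfLE hW').op) t).symm
        exact h1.trans h2
      · have : y ∈ f ⁻¹' W := by rw [hWV]; exact hyV
        exact this
    · let W : Z.Opens := ⟨(Set.range f)ᶜ, f.isClosedEmbedding.isClosed_range.isOpen_compl⟩ ⊓ U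
      have hW : f ⁻¹ᵁ W = ⊥ := by
        ext z
        simp only [TopologicalSpace.Opens.coe_bot, Set.mem_empty_iff_false, iff_false]
        exact fun hz => hz.1 ⟨z, rfl⟩
      refine ⟨W, inf_le_right, ⟨0, ?_⟩, ⟨hxf, hx⟩⟩
      have : Subsingleton (N.presheaf.obj (.op (f ⁻¹ᵁ W))) := by
        rw [hW]
        exact AddCommGrpCat.subsingleton_of_isZero
          ((TopCat.Sheaf.isTerminalOfEmpty ((toAbSheaf Y).obj N)).isZero)
      exact Subsingleton.elim (α := N.presheaf.obj (.op (f ⁻¹ᵁ W))) _ _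

instance {Y Z : Scheme.{u}} (f : Y ⟶ Z) :
    PreservesFiniteLimits (Scheme.Modules.pushforward f) := by
  have : PreservesLimits (Scheme.Modules.pushforward f) :=
    (Scheme.Modules.pullbackPushforwardAdjunction f).rightAdjoint_preservesLimits
  infer_instance

/-- Pushforward of `𝒪`-modules along a closed immersion is exact. -/
instance {Y Z : Scheme.{u}} (f : Y ⟶ Z) [IsClosedImmersion f] :
    PreservesFiniteColimits (Scheme.Modules.pushforward f) := by
  have : (Scheme.Modules.pushforward f).PreservesHomology :=
    Functor.preservesHomology_of_preservesEpis_and_kernels _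
  exact Functor.preservesFiniteColimits_of_preservesHomology _

section Sheaves

variable {Y : Scheme.{u}}

/-- The stalk `M_y` of an `𝒪_Y`-module. -/
noncomputable abbrev stalk (M : Y.Modules) (y : Y) : AddCommGrpCat.{u} :=
  TopCat.Presheaf.stalk (C := AddCommGrpCat.{u}) M.presheaf y

/-- The action of the local ring `𝒪_{Y,y}` on the stalk `M_y`. -/
noncomputable instance (M : Y.Modules) (y : Y) : Module (Y.presheaf.stalk y) (stalk M y) :=
  let M' : _root_.PresheafOfModules.{u} (Y.presheaf ⋙ forget₂ CommRingCat.{u} RingCat.{u}) := M.val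
  inferInstanceAs (Module (TopCat.Presheaf.stalk (C := CommRingCat.{u}) Y.presheaf y)
    (TopCat.Presheaf.stalk (C := AddCommGrpCat.{u}) M'.presheaf y))

/-- An `𝒪_Y`-module is flat if all its stalks are flat. -/
def IsFlatModule (M : Y.Modules) : Prop :=
  ∀ y : Y, Module.Flat (Y.presheaf.stalk y) (stalk M y)

/-- Coherent sheaves on a Noetherian scheme: quasi-coherent sheaves whose sections over each affine
open `U` form a finitely generated `Γ(Y, U)`-module. -/
def IsCoherent (M : Y.Modules) : Prop :=
  M.IsQuasicoherent ∧ ∀ U : Y.Opens, IsAffineOpen U → Module.Finite Γ(Y, U) Γ(M, U)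

/-- The support of an `𝒪_Y`-module. -/
def support (M : Y.Modules) : Set Y := {y | Nontrivial (stalk M y)}

/-- `Coh_{≤ d}(Y)`: coherent sheaves whose support has (Krull) dimension at most `d`; the zero sheaf
has empty support, of dimension `⊥`. -/
def CohLE (d : ℕ) : ObjectProperty Y.Modules := fun M =>
  IsCoherent M ∧ topologicalKrullDim (support M) ≤ d

/-- `Coh_{≥ d + 1}(Y)`: coherent sheaves that receive no nonzero morphism from an object of
`Coh_{≤ d}(Y)`. -/
def CohGT (d : ℕ) : ObjectProperty Y.Modules := fun M =>
  IsCoherent M ∧ ∀ (T : Y.Modules) (_ : CohLE d T) (g : T ⟶ M), g = 0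

end Sheaves

section Derived

variable {Y : Scheme.{u}} [HasDerivedCategory.{w} Y.Modules]

/-- `D(Y)`, the derived category of coherent sheaves, realised as the full subcategory of the derived
category of `𝒪_Y`-modules on the complexes all of whose cohomology sheaves are coherent. -/
def DCoh : ObjectProperty (DerivedCategory Y.Modules) := fun E =>
  ∀ n : ℤ, IsCoherent ((DerivedCategory.homologyFunctor Y.Modules n).obj E)

/-- `D^{≤ n}` for the t-structure on `D(Y)` obtained by tilting at the torsion pair
`(Coh_{≤ 1}(Y), Coh_{≥ 2}(Y))`: the cohomology sheaves vanish in degrees `> n`, and the one in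
degree `n` lies in `Coh_{≤ 1}(Y)`. -/
def tiltLE (n : ℤ) : ObjectProperty (DerivedCategory Y.Modules) := fun E =>
  DCoh E ∧ (∀ i : ℤ, n < i → IsZero ((DerivedCategory.homologyFunctor Y.Modules i).obj E)) ∧
    CohLE 1 ((DerivedCategory.homologyFunctor Y.Modules n).obj E)

/-- `D^{≥ n}` for the tilted t-structure on `D(Y)`: the cohomology sheaves vanish in degrees
`< n - 1`, and the one in degree `n - 1` lies in `Coh_{≥ 2}(Y)`. -/
def tiltGE (n : ℤ) : ObjectProperty (DerivedCategory Y.Modules) := fun E =>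
  DCoh E ∧ (∀ i : ℤ, i < n - 1 → IsZero ((DerivedCategory.homologyFunctor Y.Modules i).obj E)) ∧
    CohGT 1 ((DerivedCategory.homologyFunctor Y.Modules (n - 1)).obj E)

/-- The heart `𝒜^p(Y) = ⟨Coh_{≤ 1}(Y), Coh_{≥ 2}(Y)[1]⟩` of the tilted t-structure. -/
def heart : ObjectProperty (DerivedCategory Y.Modules) := tiltLE 0 ⊓ tiltGE 0

open Pretriangulated in
/-- `X` is the truncation `τ^{≤ n} E` for the tilted t-structure. -/
def IsTruncLE (n : ℤ) (E X : DerivedCategory Y.Modules) : Prop :=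
  tiltLE n X ∧ ∃ (Z : DerivedCategory Y.Modules) (_ : tiltGE (n + 1) Z)
    (f : X ⟶ E) (g : E ⟶ Z) (h : Z ⟶ X⟦(1 : ℤ)⟧), Triangle.mk f g h ∈ distTriang _

open Pretriangulated in
/-- `X` is the truncation `τ^{≥ n} E` for the tilted t-structure. -/
def IsTruncGE (n : ℤ) (E X : DerivedCategory Y.Modules) : Prop :=
  tiltGE n X ∧ ∃ (Z : DerivedCategory Y.Modules) (_ : tiltLE (n - 1) Z)
    (f : Z ⟶ E) (g : E ⟶ X) (h : X ⟶ Z⟦(1 : ℤ)⟧), Triangle.mk f g h ∈ distTriang _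

/-- `B ∈ 𝒜^p(Y)` is the `n`-th cohomology object of `E` for the tilted t-structure:
`B[-n] ≅ τ^{≥ n} τ^{≤ n} E`. -/
def IsHeartCohomology (n : ℤ) (E B : DerivedCategory Y.Modules) : Prop :=
  heart B ∧ ∃ X : DerivedCategory Y.Modules, IsTruncLE n E X ∧ IsTruncGE n X (B⟦-n⟧)

variable {Z : Scheme.{u}} [HasDerivedCategory.{w'} Z.Modules]

/-- The pushforward `f_* : D(Y) ⥤ D(Z)` along a closed immersion (exact, hence applied termwise). -/
noncomputable def derivedPushforward (f : Y ⟶ Z) [IsClosedImmersion f] :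
    DerivedCategory Y.Modules ⥤ DerivedCategory Z.Modules :=
  (Scheme.Modules.pushforward f).mapDerivedCategory

/-- `E` is the derived pullback `Lf^* F`: it is the termwise pullback of a bounded above complex of
flat `𝒪_Z`-modules that represents `F`. -/
def IsDerivedPullback (f : Y ⟶ Z) (F : DerivedCategory Z.Modules)
    (E : DerivedCategory Y.Modules) : Prop :=
  ∃ P : CochainComplex Z.Modules ℤ,
    (∃ b : ℤ, P.IsStrictlyLE b) ∧ (∀ n : ℤ, IsFlatModule (P.X n)) ∧
    Nonempty (DerivedCategory.Q.obj P ≅ F) ∧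
    Nonempty (E ≅ DerivedCategory.Q.obj
      (((Scheme.Modules.pullback f).mapHomologicalComplex (ComplexShape.up ℤ)).obj P))

end Derived

section Threefold

attribute [local instance] MvPolynomial.gradedAlgebra

/-- Projective space `ℙⁿ` over a field `k`. -/
noncomputable abbrev projectiveSpace (k : Type u) [Field k] (n : ℕ) : Scheme.{u} :=
  Proj (MvPolynomial.homogeneousSubmodule (Fin (n + 1)) k)

/-- The structure morphism of `ℙⁿ` over `k`. -/
noncomputable def projectiveSpaceStr (k : Type u) [Field k] (n : ℕ) :
    projectiveSpace k n ⟶ Spec (.of k) :=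
  Proj.toSpecZero (MvPolynomial.homogeneousSubmodule (Fin (n + 1)) k) ≫
    Spec.map (CommRingCat.ofHom
      (algebraMap k (MvPolynomial.homogeneousSubmodule (Fin (n + 1)) k 0)))

/-- `p` makes `X` a projective scheme over the field `k`. -/
def IsProjectiveOver {k : Type u} [Field k] {X : Scheme.{u}} (p : X ⟶ Spec (.of k)) : Prop :=
  ∃ (n : ℕ) (i : X ⟶ projectiveSpace k n), IsClosedImmersion i ∧ i ≫ projectiveSpaceStr k n = p

variable {k : Type u} [Field k] {X : Scheme.{u}} (p : X ⟶ Spec (.of k))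
  {R : Type u} [CommRing R] [Algebra k R] (π : R)

/-- `X_m = X ⊗_k R/π^m`. -/
noncomputable abbrev thickening (m : ℕ) : Scheme.{u} :=
  pullback p (Spec.map (CommRingCat.ofHom (algebraMap k (R ⧸ Ideal.span {π ^ m}))))

/-- The surjection `R/π^m → R/π^{m'}` for `m' ≤ m`. -/
def quotientMap {m' m : ℕ} (h : m' ≤ m) :
    (R ⧸ Ideal.span {π ^ m}) →ₐ[k] (R ⧸ Ideal.span {π ^ m'}) :=
  Ideal.Quotient.factorₐ k (Ideal.span_singleton_le_span_singleton.mpr (pow_dvd_pow π h))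

/-- The closed immersion `ι_{m,m'} : X_{m'} ⟶ X_m` for `m' ≤ m`. -/
noncomputable def thickeningι {m' m : ℕ} (h : m' ≤ m) : thickening p π m' ⟶ thickening p π m :=
  pullback.map _ _ _ _ (𝟙 X) (Spec.map (CommRingCat.ofHom (quotientMap (k := k) π h).toRingHom))
    (𝟙 _) (by simp) (by
      rw [Category.comp_id, ← Spec.map_comp, ← CommRingCat.ofHom_comp]
      congr 2)

instance {m' m : ℕ} (h : m' ≤ m) : IsClosedImmersion (thickeningι p π h) := by
  have h1 : IsClosedImmersion
      (Spec.map (CommRingCat.ofHom (quotientMap (k := k) π h).toRingHom)) :=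
    IsClosedImmersion.spec_of_surjective _ (Ideal.Quotient.factor_surjective
      (Ideal.span_singleton_le_span_singleton.mpr (pow_dvd_pow π h)))
  have : MorphismProperty.IsStableUnderComposition @IsClosedImmersion :=
    ⟨fun f g (_ : IsClosedImmersion f) (_ : IsClosedImmersion g) => inferInstance⟩
  exact MorphismProperty.pullbackMap (P := @IsClosedImmersion) inferInstance h1
    (Category.id_comp p).symm (by rw [← Spec.map_comp, ← CommRingCat.ofHom_comp]; congr 2)

end Threefold

end CoherentTilt

/-! Write `f` for the closed immersion, `G` for its pushforward, `a = π^{m'}` and `b = π^{m-m'}`. In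
`R/π^m` the annihilator of `a` is `(b)` and conversely; since `X_m` is flat over `R/π^m`,
multiplications by `a` and `b` on a flat module are exact in both orders. Let `P` be a flat complex
representing `G A`, with pullback `E`. Then `G E` is `P/aP`, which `b` identifies with `bP`, and
with `J = aP` there are triangles `G E → P → J` and `J → P → G E`
(`exists_hasTriangle_of_adjunction`). Their connecting maps compose to a periodicity map `G E → G
E⟦2⟧` controlled by `P ≅ G A`.

The tilt is not transported to `X_m`. Instead, objects of `D(X_m)` are tested by maps from images of
`D^{≤ i}`. As `A` lies in `D^{≥ 0}`, such test objects have no maps to `G A` or its relevant shifts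
when `i` is sufficiently negative, so the periodicity maps are bijective on them
(`exists_periodicity`). Truncations are characterised by these tests, and it follows that the
cohomology objects in degrees `j - 2r` and `j < 0` become isomorphic after applying `G`.

It remains to remove `G`, which need not be full on derived categories but is full between objects
of the heart (`fullAt_of_orthogonal`). Dévissage reduces this to `Ext¹` being surjective and `Ext²`
injective for a torsion `T` and a torsion-free `M`. An extension of `G T` by `G M` is acted on by
`a` through a morphism `T → M`, hence by zero, so it comes from `X_{m'}`, because modules killed by
`a` are exactly the pushforwards (`IsLocallyCutOut.mem_essImage`). A relative form of this argument,
`exists_lift_of_pushout`, handles `Ext²`. Finally `G` is conservative, so lifting an isomorphism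
gives an isomorphism. -/

namespace CoherentTilt

/-! ### Fullness and faithfulness of triangulated functors on individual Hom groups -/

section FullAt

open Pretriangulated

universe v₁ v₂ u₁ u₂

section

variable {C : Type u₁} [Category.{v₁} C] {D : Type u₂} [Category.{v₂} D] (F : C ⥤ D)

/-- `F` is surjective on morphisms `X ⟶ Y`. -/
def FullAt (X Y : C) : Prop := ∀ f : F.obj X ⟶ F.obj Y, ∃ g : X ⟶ Y, F.map g = f

/-- `F` detects the vanishing of morphisms `X ⟶ Y`. -/
def InjAt [HasZeroMorphisms C] [HasZeroMorphisms D] (X Y : C) : Prop :=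
  ∀ g : X ⟶ Y, F.map g = 0 → g = 0

variable {F}

theorem FullAt.of_iso {X Y X' Y' : C} (h : FullAt F X Y) (e : X ≅ X') (e' : Y ≅ Y') :
    FullAt F X' Y' := fun f => by
  obtain ⟨g, hg⟩ := h (F.map e.hom ≫ f ≫ F.map e'.inv)
  refine ⟨e.inv ≫ g ≫ e'.hom, ?_⟩
  rw [F.map_comp, F.map_comp, hg, Category.assoc, Category.assoc, ← F.map_comp, e'.inv_hom_id,
    F.map_id, Category.comp_id, ← F.map_comp_assoc, e.inv_hom_id, F.map_id, Category.id_comp]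

theorem InjAt.of_iso [HasZeroMorphisms C] [HasZeroMorphisms D] {X Y X' Y' : C}
    (h : InjAt F X Y) (e : X ≅ X') (e' : Y ≅ Y') : InjAt F X' Y' := fun g hg => by
  have := h (e.hom ≫ g ≫ e'.inv) (by simp [hg])
  rw [← cancel_epi e.hom, ← cancel_mono e'.inv]
  simpa using this

end

variable {C : Type u₁} [Category.{v₁} C] [Preadditive C] [HasZeroObject C] [HasShift C ℤ]
  [∀ n : ℤ, (shiftFunctor C n).Additive] [Pretriangulated C]
  {D : Type u₂} [Category.{v₂} D] [Preadditive D] [HasZeroObject D] [HasShift D ℤ]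
  [∀ n : ℤ, (shiftFunctor D n).Additive] [Pretriangulated D]
  {F : C ⥤ D} [F.CommShift ℤ] [F.IsTriangulated]

variable {X₁ X₂ X₃ : C} {u : X₁ ⟶ X₂} {v : X₂ ⟶ X₃} {w : X₃ ⟶ X₁⟦(1 : ℤ)⟧}

section Exact

variable {Y : C}

theorem dist_comp₂₃ (hT : Triangle.mk u v w ∈ distTriang C) : v ≫ w = 0 := comp_distTriang_mor_zero₂₃ _ hT

theorem dist_comp₃₁ (hT : Triangle.mk u v w ∈ distTriang C) : w ≫ u⟦(1 : ℤ)⟧' = 0 := comp_distTriang_mor_zero₃₁ _ hT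

theorem dist_lift₁ (hT : Triangle.mk u v w ∈ distTriang C) (f : Y ⟶ X₁⟦(1 : ℤ)⟧) (h : f ≫ u⟦(1 : ℤ)⟧' = 0) : ∃ g, f = g ≫ w :=
  Triangle.coyoneda_exact₁ _ hT f h

theorem dist_lift₂ (hT : Triangle.mk u v w ∈ distTriang C) (f : Y ⟶ X₂) (h : f ≫ v = 0) : ∃ g, f = g ≫ u :=
  Triangle.coyoneda_exact₂ _ hT f h

theorem dist_lift₃ (hT : Triangle.mk u v w ∈ distTriang C) (f : Y ⟶ X₃) (h : f ≫ w = 0) : ∃ g, f = g ≫ v :=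
  Triangle.coyoneda_exact₃ _ hT f h

theorem dist_desc₂ (hT : Triangle.mk u v w ∈ distTriang C) (f : X₂ ⟶ Y) (h : u ≫ f = 0) : ∃ g, f = v ≫ g :=
  Triangle.yoneda_exact₂ _ hT f h

theorem dist_desc₃ (hT : Triangle.mk u v w ∈ distTriang C) (f : X₃ ⟶ Y) (h : v ≫ f = 0) : ∃ g, f = w ≫ g :=
  Triangle.yoneda_exact₃ _ hT f h

theorem dist_desc₁ (hT : Triangle.mk u v w ∈ distTriang C) (f : X₁⟦(1 : ℤ)⟧ ⟶ Y) (h : w ≫ f = 0) : ∃ g, f = u⟦(1 : ℤ)⟧' ≫ g := by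
  obtain ⟨(k : X₂⟦(1 : ℤ)⟧ ⟶ Y), hk⟩ :=
    Triangle.yoneda_exact₃ _ (rot_of_distTriang _ hT) f h
  have hk : f = (-u⟦(1 : ℤ)⟧') ≫ k := hk
  exact ⟨-k, by rw [hk, Preadditive.comp_neg, Preadditive.neg_comp]⟩

/-- A morphism out of the first object of a distinguished triangle whose shift is killed by the
connecting morphism extends to the second object. -/
theorem dist_extend (hT : Triangle.mk u v w ∈ distTriang C) (f : X₁ ⟶ Y) (h : w ≫ f⟦(1 : ℤ)⟧' = 0) : ∃ g, f = u ≫ g := by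
  obtain ⟨k, hk⟩ := dist_desc₁ hT _ h
  obtain ⟨g, rfl⟩ := (shiftFunctor C (1 : ℤ)).map_surjective k
  exact ⟨g, (shiftFunctor C (1 : ℤ)).map_injective (by rw [hk, Functor.map_comp])⟩

theorem dist_map (hT : Triangle.mk u v w ∈ distTriang C) (F : C ⥤ D) [F.CommShift ℤ] [F.IsTriangulated] :
    Triangle.mk (F.map u) (F.map v) (F.map w ≫ (F.commShiftIso (1 : ℤ)).hom.app X₁) ∈ distTriang D :=
  F.map_distinguished _ hT

theorem dist_mor₂ {Y₁ Y₂ Y₃ : C} {u' : Y₁ ⟶ Y₂} {v' : Y₂ ⟶ Y₃} {w' : Y₃ ⟶ Y₁⟦(1 : ℤ)⟧}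
    (hT : Triangle.mk u v w ∈ distTriang C) (hT' : Triangle.mk u' v' w' ∈ distTriang C)
    (a : X₁ ⟶ Y₁) (c : X₃ ⟶ Y₃) (h : w ≫ a⟦(1 : ℤ)⟧' = c ≫ w') :
    ∃ b : X₂ ⟶ Y₂, u ≫ b = a ≫ u' ∧ v ≫ c = b ≫ v' :=
  complete_distinguished_triangle_morphism₂ _ _ hT hT' a c h

theorem dist_mor₃_isIso {Y₂ Y₃ : C} {u' : X₁ ⟶ Y₂} {v' : Y₂ ⟶ Y₃} {w' : Y₃ ⟶ X₁⟦(1 : ℤ)⟧}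
    (hT : Triangle.mk u v w ∈ distTriang C) (hT' : Triangle.mk u' v' w' ∈ distTriang C)
    (b : X₂ ≅ Y₂) (h : u ≫ b.hom = u') :
    ∃ c : X₃ ≅ Y₃, v ≫ c.hom = b.hom ≫ v' ∧ w = c.hom ≫ w' := by
  obtain ⟨(c : X₃ ⟶ Y₃), h₁, h₂⟩ := complete_distinguished_triangle_morphism (Triangle.mk u v w)
    (Triangle.mk u' v' w') hT hT' (𝟙 X₁) b.hom (by exact h.trans (Category.id_comp _).symm)
  let φ : Triangle.mk u v w ⟶ Triangle.mk u' v' w' :=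
    { hom₁ := 𝟙 X₁, hom₂ := b.hom, hom₃ := c
      comm₁ := h.trans (Category.id_comp _).symm, comm₂ := h₁, comm₃ := h₂ }
  have : IsIso c := isIso₃_of_isIso₁₂ φ hT hT' (inferInstanceAs (IsIso (𝟙 X₁)))
    (inferInstanceAs (IsIso b.hom))
  refine ⟨@asIso _ _ X₃ Y₃ c this, h₁, ?_⟩
  have h₃ : w ≫ (𝟙 X₁)⟦(1 : ℤ)⟧' = c ≫ w' := h₂
  rwa [CategoryTheory.Functor.map_id, Category.comp_id] at h₃

end Exact

/-- A four lemma by hand: the restriction of `f` to `X₁` lifts, the obstruction to extending the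
lift over `X₂` lies in `Hom(X₃, Y⟦1⟧)`, where `F` detects zero, and the remaining error factors
through `X₃`. -/
theorem fullAt_of_triangle_src (hT : Triangle.mk u v w ∈ distTriang C) {Y : C}
    (h₁ : FullAt F X₁ Y) (h₃ : FullAt F X₃ Y) (h : InjAt F X₃ (Y⟦(1 : ℤ)⟧)) :
    FullAt F X₂ Y := fun f => by
  obtain ⟨g₁, hg₁⟩ := h₁ (F.map u ≫ f)
  have hz : w ≫ g₁⟦(1 : ℤ)⟧' = 0 := h _ (by
    have h0 := dist_comp₃₁ (dist_map hT F)
    rw [← cancel_mono ((F.commShiftIso (1 : ℤ)).hom.app Y), Functor.map_comp, Category.assoc,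
      F.commShiftIso_hom_naturality, hg₁, Functor.map_comp, zero_comp,
      ← Category.assoc, ← Category.assoc, h0, zero_comp])
  obtain ⟨g₂, rfl⟩ := dist_extend hT g₁ hz
  obtain ⟨k, hk⟩ := dist_desc₂ (dist_map hT F) (f - F.map g₂) (by
    rw [Preadditive.comp_sub, ← hg₁, F.map_comp, sub_self])
  obtain ⟨g₃, rfl⟩ := h₃ k
  refine ⟨g₂ + v ≫ g₃, ?_⟩
  rw [F.map_add, F.map_comp, ← hk, add_sub_cancel]

theorem fullAt_of_triangle_tgt (hT : Triangle.mk u v w ∈ distTriang C) {Y : C}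
    (h₁ : FullAt F Y X₁) (h₃ : FullAt F Y X₃) (h : InjAt F Y (X₁⟦(1 : ℤ)⟧)) :
    FullAt F Y X₂ := fun f => by
  obtain ⟨g₃, hg₃⟩ := h₃ (f ≫ F.map v)
  have hz : g₃ ≫ w = 0 := h _ (by
    rw [F.map_comp, hg₃, Category.assoc, ← F.map_comp, dist_comp₂₃ hT, F.map_zero, comp_zero])
  obtain ⟨g₂, rfl⟩ := dist_lift₃ hT g₃ hz
  obtain ⟨k, hk⟩ := dist_lift₂ (dist_map hT F) (f - F.map g₂) (by
    rw [Preadditive.sub_comp, ← hg₃, F.map_comp, sub_self])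
  obtain ⟨g₁, rfl⟩ := h₁ k
  refine ⟨g₂ + g₁ ≫ u, ?_⟩
  rw [F.map_add, F.map_comp, ← hk, add_sub_cancel]

/-- The dual four lemma: a killed `g` comes from some `k : Y ⟶ X₁⟦1⟧` whose image is a boundary.
Fullness on `Y ⟶ X₃` lifts the bounding map, so `k` itself is a boundary. -/
theorem injAt_of_triangle_tgt (hT : Triangle.mk u v w ∈ distTriang C) {Y : C}
    (h₁ : InjAt F Y (X₁⟦(1 : ℤ)⟧)) (h₃ : InjAt F Y (X₃⟦(1 : ℤ)⟧))
    (h : FullAt F Y X₃) : InjAt F Y (X₂⟦(1 : ℤ)⟧) := fun g hg => by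
  have h1 : g ≫ v⟦(1 : ℤ)⟧' = 0 := h₃ _ (by rw [F.map_comp, hg, zero_comp])
  obtain ⟨k, hk⟩ : ∃ k, g = k ≫ u⟦(1 : ℤ)⟧' := by
    obtain ⟨k, hk⟩ := dist_lift₁ (rot_of_distTriang _ hT) g h1
    exact ⟨-k, hk.trans ((Preadditive.comp_neg _ _).trans (Preadditive.neg_comp _ _).symm)⟩
  obtain ⟨m, hm⟩ := dist_lift₁ (dist_map hT F) (F.map k ≫ (F.commShiftIso (1 : ℤ)).hom.app X₁) (by
    rw [Category.assoc, ← F.commShiftIso_hom_naturality, ← F.map_comp_assoc, ← hk, hg, zero_comp])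
  obtain ⟨n, rfl⟩ := h m
  have h2 : k - n ≫ w = 0 := h₁ _ (by
    rw [F.map_sub, F.map_comp, sub_eq_zero, ← cancel_mono ((F.commShiftIso (1 : ℤ)).hom.app X₁),
      hm, Category.assoc])
  rw [sub_eq_zero] at h2
  rw [hk, h2, Category.assoc, dist_comp₃₁ hT, comp_zero]

/-- Injectivity on extensions: if `F` is full on maps from `X` into every extension of `X` by `Y`,
then `F` is injective on `Hom(X, Y⟦1⟧)`. -/
theorem injAt_shift_one {X Y : C} (hX : InjAt F X X)
    (h : ∀ (V : C) (u : Y ⟶ V) (v : V ⟶ X) (w : X ⟶ Y⟦(1 : ℤ)⟧),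
      Triangle.mk u v w ∈ distTriang C → FullAt F X V) :
    InjAt F X (Y⟦(1 : ℤ)⟧) := fun g hg => by
  -- `g` is the class of the extension `V`. Since `F.map g = 0`, the image of `V` splits, and
  -- fullness lifts the splitting.
  obtain ⟨V, u, v, hT⟩ := distinguished_cocone_triangle₂ g
  obtain ⟨s, hs⟩ := dist_lift₃ (dist_map hT F) (𝟙 _) (by rw [hg, zero_comp, comp_zero])
  obtain ⟨s, rfl⟩ := h V u v g hT s
  have h1 : s ≫ v - 𝟙 X = 0 := hX _ (by
    rw [F.map_sub, F.map_comp, F.map_id, sub_eq_zero]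
    exact hs.symm)
  rw [sub_eq_zero] at h1
  rw [← Category.id_comp g, ← h1, Category.assoc, dist_comp₂₃ hT, comp_zero]

end FullAt

/-! ### Exact functors and natural endomorphisms on derived categories -/

section DerivedExact

open Pretriangulated DerivedCategory

universe v₁ v₂ u₁ u₂

section

variable {B : Type u₂} [Category.{v₂} B] [Abelian B]

/-- The endomorphism of the identity functor of complexes induced by an endomorphism of the
identity functor. -/
@[simps]
def complexEnd (t : 𝟭 B ⟶ 𝟭 B) : 𝟭 (CochainComplex B ℤ) ⟶ 𝟭 (CochainComplex B ℤ) where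
  app K :=
    { f := fun n => t.app (K.X n)
      comm' := fun i j _ => (t.naturality (K.d i j)).symm }
  naturality K L φ := by
    ext n
    exact t.naturality (φ.f n)

variable [HasDerivedCategory.{w'} B]

noncomputable instance : Localization.Lifting (Q (C := B))
    (HomologicalComplex.quasiIso B (ComplexShape.up ℤ)) Q (𝟭 (DerivedCategory B)) :=
  ⟨Functor.rightUnitor _⟩

/-- The endomorphism of the identity functor of the derived category induced by an endomorphism of
the identity functor. -/
noncomputable def derivedEnd (t : 𝟭 B ⟶ 𝟭 B) :
    𝟭 (DerivedCategory B) ⟶ 𝟭 (DerivedCategory B) :=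
  Localization.liftNatTrans Q (HomologicalComplex.quasiIso B (ComplexShape.up ℤ)) Q Q _ _
    (Functor.whiskerRight (complexEnd t) Q)

theorem derivedEnd_app_Q (t : 𝟭 B ⟶ 𝟭 B) (K : CochainComplex B ℤ) :
    (derivedEnd t).app (Q.obj K) = Q.map ((complexEnd t).app K) := by
  rw [derivedEnd, Localization.liftNatTrans_app]
  exact (Category.id_comp _).trans (Category.comp_id _)

theorem derivedEnd_app_single (t : 𝟭 B ⟶ 𝟭 B) (n : ℤ) (M : B) :
    (derivedEnd t).app ((singleFunctor B n).obj M) = (singleFunctor B n).map (t.app M) := by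
  refine (derivedEnd_app_Q t ((HomologicalComplex.single B (ComplexShape.up ℤ) n).obj M)).trans ?_
  have : (complexEnd t).app ((HomologicalComplex.single B (ComplexShape.up ℤ) n).obj M) =
      (HomologicalComplex.single B (ComplexShape.up ℤ) n).map (t.app M) := by
    apply HomologicalComplex.from_single_hom_ext
    have h := t.naturality (HomologicalComplex.singleObjXSelf (ComplexShape.up ℤ) n M).hom
    rw [HomologicalComplex.single_map_f_self, ← Category.assoc]
    exact (Iso.eq_comp_inv _).2 h.symm
  rw [this]
  rfl

end

variable {A : Type u₁} [Category.{v₁} A] [Abelian A] [HasDerivedCategory.{w} A]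
  {B : Type u₂} [Category.{v₂} B] [Abelian B] [HasDerivedCategory.{w'} B]
  (G : A ⥤ B) [G.Additive] [PreservesFiniteLimits G] [PreservesFiniteColimits G]

theorem isLE_mapDerivedCategory (X : DerivedCategory A) (n : ℤ) [X.IsLE n] :
    (G.mapDerivedCategory.obj X).IsLE n := by
  obtain ⟨K, _, ⟨e⟩⟩ := X.exists_iso_Q_obj_of_isLE n
  exact ⟨_, G.mapDerivedCategory.mapIso e ≪≫ G.mapDerivedCategoryFactors.app K, inferInstance⟩

theorem isGE_mapDerivedCategory (X : DerivedCategory A) (n : ℤ) [X.IsGE n] :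
    (G.mapDerivedCategory.obj X).IsGE n := by
  obtain ⟨K, _, ⟨e⟩⟩ := X.exists_iso_Q_obj_of_isGE n
  exact ⟨_, G.mapDerivedCategory.mapIso e ≪≫ G.mapDerivedCategoryFactors.app K, inferInstance⟩

theorem isZero_iff_homology (X : DerivedCategory A) :
    IsZero X ↔ ∀ n, IsZero ((homologyFunctor A n).obj X) := by
  refine ⟨fun h n => (homologyFunctor A n).map_isZero h, fun h => ?_⟩
  have h1 : X.IsLE 0 := (isLE_iff _ _).2 fun i _ => h i
  have h2 : X.IsGE 1 := (isGE_iff _ _).2 fun i _ => h i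
  exact TStructure.t.isZero X 0 1

theorem isZero_Q_iff (K : CochainComplex A ℤ) : IsZero (Q.obj K) ↔ ∀ n, K.ExactAt n := by
  rw [isZero_iff_homology]
  refine forall_congr' fun n => ?_
  rw [HomologicalComplex.exactAt_iff_isZero_homology]
  exact ((homologyFunctorFactors A n).app K).isZero_iff

theorem isZero_of_isZero_map [G.Faithful] (X : DerivedCategory A)
    (h : IsZero (G.mapDerivedCategory.obj X)) : IsZero X := by
  obtain ⟨K, ⟨e⟩⟩ : ∃ K, Nonempty (Q.obj K ≅ X) := ⟨_, ⟨Q.objObjPreimageIso X⟩⟩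
  have h1 : IsZero (Q.obj ((G.mapHomologicalComplex (ComplexShape.up ℤ)).obj K)) :=
    h.of_iso ((G.mapDerivedCategory.mapIso e.symm ≪≫ G.mapDerivedCategoryFactors.app K).symm)
  rw [isZero_Q_iff] at h1
  refine IsZero.of_iso ?_ e.symm
  rw [isZero_Q_iff]
  intro n
  exact (ShortComplex.exact_map_iff_of_faithful (K.sc n) G).1 (h1 n)

theorem isLE_of_isLE_map [G.Faithful] (X : DerivedCategory A) (n : ℤ)
    (h : (G.mapDerivedCategory.obj X).IsLE n) : X.IsLE n := by
  obtain ⟨K, ⟨e⟩⟩ : ∃ K, Nonempty (Q.obj K ≅ X) := ⟨_, ⟨Q.objObjPreimageIso X⟩⟩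
  have h1 : (Q.obj ((G.mapHomologicalComplex (ComplexShape.up ℤ)).obj K)).IsLE n :=
    TStructure.t.isLE_of_iso (G.mapDerivedCategory.mapIso e.symm ≪≫
      G.mapDerivedCategoryFactors.app K) n
  rw [isLE_Q_obj_iff, CochainComplex.isLE_iff] at h1
  have h2 : (Q.obj K).IsLE n := by
    rw [isLE_Q_obj_iff, CochainComplex.isLE_iff]
    exact fun i hi => (ShortComplex.exact_map_iff_of_faithful (K.sc i) G).1 (h1 i hi)
  exact TStructure.t.isLE_of_iso e n

theorem isGE_of_isGE_map [G.Faithful] (X : DerivedCategory A) (n : ℤ)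
    (h : (G.mapDerivedCategory.obj X).IsGE n) : X.IsGE n := by
  obtain ⟨K, ⟨e⟩⟩ : ∃ K, Nonempty (Q.obj K ≅ X) := ⟨_, ⟨Q.objObjPreimageIso X⟩⟩
  have h1 : (Q.obj ((G.mapHomologicalComplex (ComplexShape.up ℤ)).obj K)).IsGE n :=
    TStructure.t.isGE_of_iso (G.mapDerivedCategory.mapIso e.symm ≪≫
      G.mapDerivedCategoryFactors.app K) n
  rw [isGE_Q_obj_iff, CochainComplex.isGE_iff] at h1
  have h2 : (Q.obj K).IsGE n := by
    rw [isGE_Q_obj_iff, CochainComplex.isGE_iff]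
    exact fun i hi => (ShortComplex.exact_map_iff_of_faithful (K.sc i) G).1 (h1 i hi)
  exact TStructure.t.isGE_of_iso e n

/-- Exact faithful functors reflect acyclicity, so the cone of `f` vanishes as soon as its image
does. -/
theorem isIso_of_isIso_map [G.Faithful] {X Y : DerivedCategory A} (f : X ⟶ Y)
    [h : IsIso (G.mapDerivedCategory.map f)] : IsIso f := by
  obtain ⟨Z, g, k, hT⟩ := distinguished_cocone_triangle f
  have h1 := (Triangle.isZero₃_iff_isIso₁ _ (dist_map hT G.mapDerivedCategory)).2 h
  exact (Triangle.isZero₃_iff_isIso₁ _ hT).1 (isZero_of_isZero_map G _ h1)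

variable {G}

theorem fullAt_single [G.Full] (n : ℤ) (M N : A) :
    FullAt G.mapDerivedCategory ((singleFunctor A n).obj M) ((singleFunctor A n).obj N) := fun f => by
  let e := G.mapDerivedCategorySingleFunctor n
  obtain ⟨g, hg⟩ := (singleFunctor B n).map_surjective (e.inv.app M ≫ f ≫ e.hom.app N)
  obtain ⟨g, rfl⟩ := G.map_surjective g
  refine ⟨(singleFunctor A n).map g, ?_⟩
  have h1 : G.mapDerivedCategory.map ((singleFunctor A n).map g) ≫ e.hom.app N =
    e.hom.app M ≫ (singleFunctor B n).map (G.map g) := e.hom.naturality g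
  rw [← cancel_mono (e.hom.app N), h1, hg]
  exact e.hom_inv_id_app_assoc M _

theorem injAt_single [G.Faithful] (n : ℤ) (M N : A) :
    InjAt G.mapDerivedCategory ((singleFunctor A n).obj M) ((singleFunctor A n).obj N) :=
    fun g hg => by
  let e := G.mapDerivedCategorySingleFunctor n
  obtain ⟨g, rfl⟩ := (singleFunctor A n).map_surjective g
  have h1 : G.mapDerivedCategory.map ((singleFunctor A n).map g) ≫ e.hom.app N =
    e.hom.app M ≫ (singleFunctor B n).map (G.map g) := e.hom.naturality g
  rw [hg, zero_comp] at h1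
  have h2 : (singleFunctor B n).map (G.map g) = 0 := by
    rw [← cancel_epi (e.hom.app M), ← h1, comp_zero]
  have h3 : G.map g = 0 := (singleFunctor B n).map_injective (by rw [h2, Functor.map_zero])
  have h4 : g = 0 := G.map_injective (by rw [h3, G.map_zero])
  rw [h4, Functor.map_zero]

theorem exists_iso_single_of_extension {V X Y : DerivedCategory A} {u : X ⟶ V} {v : V ⟶ Y}
    {w : Y ⟶ X⟦(1 : ℤ)⟧} (hT : Triangle.mk u v w ∈ distTriang _) (n : ℤ)
    (h₁ : X.IsGE n) (h₂ : X.IsLE n) (h₃ : Y.IsGE n) (h₄ : Y.IsLE n) :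
    ∃ V₀ : A, Nonempty (V ≅ (singleFunctor A n).obj V₀) := by
  have : V.IsLE n := TStructure.t.isLE₂ _ hT n h₂ h₄
  have : V.IsGE n := TStructure.t.isGE₂ _ hT n h₁ h₃
  exact exists_iso_singleFunctor_obj_of_isGE_of_isLE V n

/-- Injectivity on `Ext¹`: an extension of two objects in degree `n` is again a single object, and
on those `G` is full, so splittings lift. -/
theorem injAt_single_shift_one [G.Full] [G.Faithful] (n : ℤ) (T N : A) :
    InjAt G.mapDerivedCategory ((singleFunctor A n).obj T)
      (((singleFunctor A n).obj N)⟦(1 : ℤ)⟧) := by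
  refine injAt_shift_one (injAt_single n T T) fun V u v w hT => ?_
  obtain ⟨V₀, ⟨e⟩⟩ := exists_iso_single_of_extension hT n inferInstance inferInstance inferInstance
    inferInstance
  exact (fullAt_single n T V₀).of_iso (Iso.refl _) e.symm

/-- The vanishing holds in the derived category and not merely on cohomology, because `t` is already
zero on each term of a complex in the image of `G`. -/
theorem derivedEnd_app_map {t : 𝟭 B ⟶ 𝟭 B} (ht : ∀ M : A, t.app (G.obj M) = 0)
    (X : DerivedCategory A) : (derivedEnd t).app (G.mapDerivedCategory.obj X) = 0 := by
  obtain ⟨K, ⟨e⟩⟩ : ∃ K, Nonempty (Q.obj K ≅ X) := ⟨_, ⟨Q.objObjPreimageIso X⟩⟩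
  let e' := (G.mapDerivedCategory.mapIso e.symm ≪≫ G.mapDerivedCategoryFactors.app K)
  have h := (derivedEnd t).naturality e'.hom
  have h2 : (derivedEnd t).app (Q.obj ((G.mapHomologicalComplex (ComplexShape.up ℤ)).obj K)) = 0 := by
    rw [derivedEnd_app_Q, ← Q.map_zero]
    congr 1
    ext n
    exact ht _
  have h3 : (derivedEnd t).app (G.mapDerivedCategory.obj X) ≫ e'.hom = 0 := by
    refine h.symm.trans ?_
    exact (congrArg (fun z => e'.hom ≫ z) h2).trans comp_zero
  rw [← cancel_mono e'.hom, h3, zero_comp]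

end DerivedExact

/-! ### Descending extensions along `G` -/

section Lifting

open Pretriangulated DerivedCategory

universe v₁ v₂ u₁ u₂

variable {A : Type u₁} [Category.{v₁} A] [Abelian A] [HasDerivedCategory.{w} A]
  {B : Type u₂} [Category.{v₂} B] [Abelian B] [HasDerivedCategory.{w'} B]
  {G : A ⥤ B} [G.Additive] [PreservesFiniteLimits G] [PreservesFiniteColimits G]

local notation "S₀" => singleFunctor A 0

theorem hom_eq_zero_of_lt {X Y : DerivedCategory A} (f : X ⟶ Y) (a b : ℤ) (h : a < b)
    (hX : X.IsLE a) (hY : Y.IsGE b) : f = 0 :=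
  TStructure.t.zero f a b h

/-- An extension of `G T` by `G I` in `B` comes from `A` if its pushout along `p : I ⟶ N` does and
no nonzero morphism `T ⟶ I` is killed by `p`: the obstruction is the action of `t` on the extension,
which factors through such a morphism. -/
theorem exists_lift_of_pushout [G.Full] [G.Faithful] {t : 𝟭 B ⟶ 𝟭 B}
    (ht : ∀ M : A, t.app (G.obj M) = 0) (ht' : ∀ N : B, t.app N = 0 → G.essImage N)
    {T I N : A} (p : I ⟶ N) (hp : ∀ τ : T ⟶ I, τ ≫ p = 0 → τ = 0)
    (z : G.mapDerivedCategory.obj ((S₀).obj T) ⟶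
      G.mapDerivedCategory.obj (((S₀).obj I)⟦(1 : ℤ)⟧))
    (y : (S₀).obj T ⟶ ((S₀).obj N)⟦(1 : ℤ)⟧)
    (hz : z ≫ G.mapDerivedCategory.map (((S₀).map p)⟦(1 : ℤ)⟧') = G.mapDerivedCategory.map y) :
    ∃ z', G.mapDerivedCategory.map z' = z := by
  have hLE (n : ℤ) (X : DerivedCategory A) (_ : X.IsLE n) : (G.mapDerivedCategory.obj X).IsLE n :=
    isLE_mapDerivedCategory G X n
  have hGE (n : ℤ) (X : DerivedCategory A) (_ : X.IsGE n) : (G.mapDerivedCategory.obj X).IsGE n :=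
    isGE_mapDerivedCategory G X n
  have hT1 : (G.mapDerivedCategory.obj ((S₀).obj T)).IsLE 0 := hLE _ _ inferInstance
  have hT2 : (G.mapDerivedCategory.obj ((S₀).obj T)).IsGE 0 := hGE _ _ inferInstance
  have hI1 : (G.mapDerivedCategory.obj ((S₀).obj I)).IsLE 0 := hLE _ _ inferInstance
  have hI2 : (G.mapDerivedCategory.obj ((S₀).obj I)).IsGE 0 := hGE _ _ inferInstance
  have lt {X Y : DerivedCategory B} (f : X⟦(1 : ℤ)⟧ ⟶ Y) (_ : X.IsLE 0) (_ : Y.IsGE 0) : f = 0 :=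
    hom_eq_zero_of_lt f (-1) 0 (by lia) (TStructure.t.isLE_shift _ 0 1 (-1) (by lia)) ‹_›
  obtain ⟨V, uV, vV, hV⟩ := distinguished_cocone_triangle₂ y
  have hV2 : (G.mapDerivedCategory.obj V).IsGE 0 := hGE _ _ (TStructure.t.isGE₂ _ hV 0
    (inferInstanceAs (((S₀).obj N).IsGE 0)) (inferInstanceAs (((S₀).obj T).IsGE 0)))
  have hFV := dist_map hV G.mapDerivedCategory
  let c := G.mapDerivedCategory.commShiftIso (1 : ℤ)
  -- `W` is the extension classified by `z`, and `ω` below maps it to the image of the extension `V`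
  -- classified by `y`.
  obtain ⟨W, u, v, hW⟩ := distinguished_cocone_triangle₂ (z ≫ c.hom.app ((S₀).obj I))
  obtain ⟨W₀, ⟨e⟩⟩ := exists_iso_single_of_extension hW 0 hI2 hI1 hT2 hT1
  obtain ⟨ω, hω, hω'⟩ := dist_mor₂ hW hFV (G.mapDerivedCategory.map ((S₀).map p)) (𝟙 _) (by
      rw [Category.assoc, ← G.mapDerivedCategory.commShiftIso_hom_naturality, ← Category.assoc, hz, Category.id_comp])
  let t' := derivedEnd t
  have ht0 (X : DerivedCategory A) : t'.app (G.mapDerivedCategory.obj X) = 0 := derivedEnd_app_map ht X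
  -- By naturality `t'` on `W` dies on the sub, on the quotient and in `V`. The first two write it
  -- as `v ≫ τ ≫ u`, and the third gives `τ ≫ p = 0`.
  have n1 : u ≫ t'.app W = 0 := (t'.naturality u).trans (by rw [ht0, zero_comp])
  have n2 : t'.app W ≫ v = 0 := (t'.naturality v).symm.trans (by rw [ht0, comp_zero])
  have n3 : t'.app W ≫ ω = 0 := (t'.naturality ω).symm.trans (by rw [ht0, comp_zero])
  obtain ⟨s, hs⟩ := dist_desc₂ hW (t'.app W) n1
  -- In the derived category `v` and `uV` can be cancelled only against objects of `D^{≥ 0}` and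
  -- `D^{≤ 0}` respectively, which suffices here.
  have epi_v {Y : DerivedCategory B} (hY : Y.IsGE 0) (x : G.mapDerivedCategory.obj ((S₀).obj T) ⟶ Y)
      (hx : v ≫ x = 0) : x = 0 := by
    obtain ⟨k, rfl⟩ := dist_desc₃ hW x hx
    rw [lt k hI1 hY, comp_zero]
  have mono_uV {X : DerivedCategory B} (hX : X.IsLE 0) (x : X ⟶ G.mapDerivedCategory.obj ((S₀).obj N))
      (hx : x ≫ G.mapDerivedCategory.map uV = 0) : x = 0 := by
    have hx' : x⟦(1 : ℤ)⟧' ≫ (G.mapDerivedCategory.map uV)⟦(1 : ℤ)⟧' = 0 := by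
      rw [← Functor.map_comp, hx, Functor.map_zero]
    obtain ⟨k, hk⟩ := dist_lift₁ hFV _ hx'
    rw [lt k hX hT2, zero_comp] at hk
    exact (shiftFunctor _ (1 : ℤ)).map_injective (by rw [hk, Functor.map_zero])
  have hsv : s ≫ v = 0 := epi_v hT2 _ (by rw [← Category.assoc, ← hs, n2])
  obtain ⟨τ, rfl⟩ := dist_lift₂ hW s hsv
  have hτ : (τ ≫ G.mapDerivedCategory.map ((S₀).map p)) = 0 := by
    refine mono_uV hT1 _ (epi_v hV2 _ ?_)
    rw [Category.assoc, ← hω, ← Category.assoc, ← Category.assoc, Category.assoc v τ u, ← hs, n3]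
  obtain ⟨τ, rfl⟩ := fullAt_single 0 T I τ
  obtain ⟨τ, rfl⟩ := (S₀).map_surjective τ
  rw [← G.mapDerivedCategory.map_comp] at hτ
  have h1 : τ ≫ p = 0 := (S₀).map_injective (by
    rw [Functor.map_comp, injAt_single (G := G) 0 _ _ _ hτ, Functor.map_zero])
  rw [hp τ h1, Functor.map_zero, Functor.map_zero, zero_comp, comp_zero] at hs
  have h2 : t.app W₀ = 0 := by
    apply (singleFunctor B 0).map_injective
    rw [← derivedEnd_app_single, Functor.map_zero, ← cancel_epi e.hom, comp_zero]
    refine (t'.naturality e.hom).trans ?_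
    rw [hs, zero_comp]
  obtain ⟨W₁, ⟨e₁⟩⟩ := ht' W₀ h2
  let e₂ : W ≅ G.mapDerivedCategory.obj ((S₀).obj W₁) :=
    e ≪≫ (singleFunctor B 0).mapIso e₁.symm ≪≫ (G.mapDerivedCategorySingleFunctor 0).symm.app W₁
  obtain ⟨u', hu'⟩ := fullAt_single (G := G) 0 I W₁ (u ≫ e₂.hom)
  -- `W` now comes from `W₁` in `A`. The cone of the lifted inclusion maps to `G T` up to
  -- isomorphism and is a single object in degree `0`, so the comparison `φ` lifts and gives the
  -- class `z'`.
  obtain ⟨Q', v', w', hQ⟩ := distinguished_cocone_triangle u'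
  obtain ⟨φ, -, hφ⟩ := dist_mor₃_isIso hW (dist_map hQ G.mapDerivedCategory) e₂ hu'.symm
  have hφ' : z = φ.hom ≫ G.mapDerivedCategory.map w' := by
    rw [← cancel_mono (c.hom.app ((S₀).obj I)), hφ, Category.assoc]
  have hQ1 : Q'.IsLE 0 := isLE_of_isLE_map (G := G) _ _ (TStructure.t.isLE_of_iso φ 0)
  have hQ2 : Q'.IsGE 0 := isGE_of_isGE_map (G := G) _ _ (TStructure.t.isGE_of_iso φ 0)
  obtain ⟨Q₀, ⟨eQ⟩⟩ := exists_iso_singleFunctor_obj_of_isGE_of_isLE Q' 0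
  obtain ⟨ψ, hψ⟩ := (fullAt_single (G := G) 0 T Q₀).of_iso (Iso.refl _) eQ.symm φ.hom
  exact ⟨ψ ≫ w', by rw [Functor.map_comp, hψ, hφ']⟩

end Lifting

/-! ### Fullness of `G` on the tilted heart -/

section HeartFull

open Pretriangulated DerivedCategory

universe v₁ v₂ u₁ u₂

variable {A : Type u₁} [Category.{v₁} A] [Abelian A] [HasDerivedCategory.{w} A]

theorem dist_shift_one {C : Type u₁} [Category.{v₁} C] [Preadditive C] [HasZeroObject C]
    [HasShift C ℤ] [∀ n : ℤ, (shiftFunctor C n).Additive] [Pretriangulated C]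
    {X₁ X₂ X₃ : C} {u : X₁ ⟶ X₂} {v : X₂ ⟶ X₃} {w : X₃ ⟶ X₁⟦(1 : ℤ)⟧}
    (hT : Triangle.mk u v w ∈ distTriang C) :
    Triangle.mk (-u⟦(1 : ℤ)⟧') (-v⟦(1 : ℤ)⟧') (-w⟦(1 : ℤ)⟧') ∈ distTriang C :=
  rot_of_distTriang _ (rot_of_distTriang _ (rot_of_distTriang _ hT))

theorem isLE_shift_of_le (X : DerivedCategory A) (n a m : ℤ) (h : n - a ≤ m) [X.IsLE n] :
    (X⟦a⟧).IsLE m := by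
  have := TStructure.t.isLE_shift X n a (n - a) (by lia)
  exact TStructure.t.isLE_of_le (X⟦a⟧) (n - a) m h

theorem isGE_shift_of_le (X : DerivedCategory A) (n a m : ℤ) (h : m ≤ n - a) [X.IsGE n] :
    (X⟦a⟧).IsGE m := by
  have := TStructure.t.isGE_shift X n a (n - a) (by lia)
  exact TStructure.t.isGE_of_ge (X⟦a⟧) m (n - a) h

/-- Every class in `Ext²(T, M)` is killed by some monomorphism out of `M`. -/
theorem exists_mono_effacing (T M : A)
    (g : (singleFunctor A 0).obj T ⟶ (((singleFunctor A 0).obj M)⟦(1 : ℤ)⟧)⟦(1 : ℤ)⟧) :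
    ∃ (I : A) (i : M ⟶ I) (_ : Mono i), g ≫ (((singleFunctor A 0).map i)⟦(1 : ℤ)⟧')⟦(1 : ℤ)⟧' = 0 := by
  let e₁ := (singleFunctors A).shiftIso 1 (-1) 0 (by lia)
  let e₂ := (singleFunctors A).shiftIso 1 (-2) (-1) (by lia)
  let e (N : A) : (((singleFunctor A 0).obj N)⟦(1 : ℤ)⟧)⟦(1 : ℤ)⟧ ≅ (singleFunctor A (-2)).obj N :=
    (shiftFunctor _ (1 : ℤ)).mapIso (e₁.app N) ≪≫ e₂.app N
  have he {N N' : A} (f : N ⟶ N') : (((singleFunctor A 0).map f)⟦(1 : ℤ)⟧')⟦(1 : ℤ)⟧' ≫ (e N').hom =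
      (e N).hom ≫ (singleFunctor A (-2)).map f := by
    have h1 : ((singleFunctor A 0).map f)⟦(1 : ℤ)⟧' ≫ e₁.hom.app N' = e₁.hom.app N ≫ _ :=
      e₁.hom.naturality f
    have h2 : ((singleFunctor A (-1)).map f)⟦(1 : ℤ)⟧' ≫ e₂.hom.app N' = e₂.hom.app N ≫ _ :=
      e₂.hom.naturality f
    change _ ≫ (e₁.hom.app N')⟦(1 : ℤ)⟧' ≫ e₂.hom.app N' =
      ((e₁.hom.app N)⟦(1 : ℤ)⟧' ≫ e₂.hom.app N) ≫ _
    rw [← Functor.map_comp_assoc, h1, Functor.map_comp, Category.assoc, h2, Category.assoc]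
  let single (n : ℤ) := HomologicalComplex.single A (ComplexShape.up ℤ) n
  let g' : Q.obj ((single 0).obj T) ⟶ Q.obj ((single (-2)).obj M) := g ≫ (e M).hom
  -- Write the class as a fraction with denominator a quasi-isomorphism `s` from `M` in degree `-2`
  -- to a complex `Y` starting in degree `-2`. The effacing object is the bottom term `Y.X (-2)`:
  -- the numerator starts in degree `0`, so it dies under projection to that term.
  obtain ⟨Y, hY, a, s, hs, hg⟩ := left_fac_of_isStrictlyGE g' (-2)
  let i : M ⟶ Y.X (-2) :=
    (HomologicalComplex.singleObjXSelf (ComplexShape.up ℤ) (-2) M).inv ≫ s.f (-2)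
  have hi : Mono i := by
    refine Preadditive.mono_of_cancel_zero _ fun {K} k hk => ?_
    have h1 : (single (-2)).map k ≫ s = 0 := by
      apply HomologicalComplex.from_single_hom_ext
      rw [HomologicalComplex.comp_f, HomologicalComplex.single_map_f_self]
      simp only [Category.assoc, HomologicalComplex.zero_f]
      change _ ≫ k ≫ i = _
      rw [hk, comp_zero]
    have h2 : Q.map ((single (-2)).map k) = 0 := by
      rw [← cancel_mono (Q.map s), ← Q.map_comp, h1, Q.map_zero, zero_comp]
    exact (singleFunctor A (-2)).map_injective (by rw [Functor.map_zero]; exact h2)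
  let pr : Y ⟶ (single (-2)).obj (Y.X (-2)) :=
    HomologicalComplex.mkHomToSingle (𝟙 _) fun j hj => by
      have : j = -3 := by
        have : j + 1 = -2 := hj
        lia
      exact (Y.isZero_of_isStrictlyGE (-2) j (by lia)).eq_of_src _ _
  have h1 : s ≫ pr = (single (-2)).map i := by
    apply HomologicalComplex.from_single_hom_ext
    rw [HomologicalComplex.comp_f, HomologicalComplex.single_map_f_self]
    simp [pr, i]
  have h2 : a ≫ pr = 0 := by
    apply HomologicalComplex.from_single_hom_ext
    exact (HomologicalComplex.isZero_single_obj_X _ _ _ _ (by lia)).eq_of_tgt _ _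
  refine ⟨_, i, hi, ?_⟩
  rw [← cancel_mono (e _).hom, Category.assoc, he, zero_comp, ← Category.assoc]
  change g' ≫ Q.map ((single (-2)).map i) = 0
  rw [hg, ← h1, Q.map_comp, Category.assoc, IsIso.inv_hom_id_assoc, ← Q.map_comp, h2, Q.map_zero]

theorem isIso_homologyMap_of_triangle {X₁ X₂ X₃ : DerivedCategory A} {u : X₁ ⟶ X₂} {v : X₂ ⟶ X₃}
    {w : X₃ ⟶ X₁⟦(1 : ℤ)⟧} (hT : Triangle.mk u v w ∈ distTriang _) (n : ℤ) (h : X₁.IsLE (n - 1)) :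
    IsIso ((homologyFunctor A n).map v) := by
  have h1 : Mono ((homologyFunctor A n).map v) := (HomologySequence.mono_homologyMap_mor₂_iff _ hT n).2
    ((isZero_of_isLE X₁ (n - 1) n (by lia)).eq_of_src _ _)
  have h2 : Epi ((homologyFunctor A n).map v) :=
    (HomologySequence.epi_homologyMap_mor₂_iff _ hT n (n + 1) rfl).2
      ((isZero_of_isLE X₁ (n - 1) (n + 1) (by lia)).eq_of_tgt _ _)
  exact isIso_of_mono_of_epi _

theorem isIso_homologyMap_of_triangle' {X₁ X₂ X₃ : DerivedCategory A} {u : X₁ ⟶ X₂} {v : X₂ ⟶ X₃}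
    {w : X₃ ⟶ X₁⟦(1 : ℤ)⟧} (hT : Triangle.mk u v w ∈ distTriang _) (n : ℤ) (h : X₃.IsGE (n + 1)) :
    IsIso ((homologyFunctor A n).map u) := by
  have h1 : Epi ((homologyFunctor A n).map u) := (HomologySequence.epi_homologyMap_mor₁_iff _ hT n).2
    ((isZero_of_isGE X₃ (n + 1) n (by lia)).eq_of_tgt _ _)
  have h2 : Mono ((homologyFunctor A n).map u) :=
    (HomologySequence.mono_homologyMap_mor₁_iff _ hT (n - 1) n (by lia)).2
      ((isZero_of_isGE X₃ (n + 1) (n - 1) (by lia)).eq_of_src _ _)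
  exact isIso_of_mono_of_epi _

/-- The top cohomology of an object of `D^{≤ n}`, as the third term of a triangle. -/
theorem exists_triangle_top (X : DerivedCategory A) (n : ℤ) (hX : X.IsLE n) :
    ∃ (X' : DerivedCategory A) (_ : X'.IsLE (n - 1)) (T : A)
      (_ : Nonempty ((homologyFunctor A n).obj X ≅ T)) (u : X' ⟶ X)
      (v : X ⟶ (singleFunctor A n).obj T) (w : _ ⟶ X'⟦(1 : ℤ)⟧),
      Triangle.mk u v w ∈ distTriang _ := by
  obtain ⟨X', X'', h', h'', u, v, w, hT⟩ := TStructure.t.exists_triangle X (n - 1) n (by lia)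
  have h1 : X'.IsLE (n - 1) := ⟨h'⟩
  have h2 : X''.IsGE n := ⟨h''⟩
  have h3 : X''.IsLE n := TStructure.t.isLE₂ _ (rot_of_distTriang _ hT) n hX
    (isLE_shift_of_le X' (n - 1) 1 n (by lia))
  obtain ⟨T, ⟨e⟩⟩ := exists_iso_singleFunctor_obj_of_isGE_of_isLE X'' n
  have := isIso_homologyMap_of_triangle hT n h1
  refine ⟨X', h1, T, ⟨asIso ((homologyFunctor A n).map v) ≪≫ (homologyFunctor A n).mapIso e ≪≫
    (singleFunctorCompHomologyFunctorIso A n).app T⟩, u, v ≫ e.hom, e.inv ≫ w, ?_⟩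
  refine isomorphic_distinguished _ hT _
    (Triangle.isoMk _ _ (Iso.refl _) (Iso.refl _) e.symm ?_ ?_ ?_)
  · exact (Category.comp_id _).trans (Category.id_comp _).symm
  · change (v ≫ e.hom) ≫ e.inv = 𝟙 _ ≫ v
    simp
  · change (e.inv ≫ w) ≫ (𝟙 X')⟦(1 : ℤ)⟧' = e.inv ≫ w
    simp

/-- The bottom cohomology of an object of `D^{≥ n}`, as the first term of a triangle. -/
theorem exists_triangle_bot (X : DerivedCategory A) (n : ℤ) (hX : X.IsGE n) :
    ∃ (X'' : DerivedCategory A) (_ : X''.IsGE (n + 1)) (M : A)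
      (_ : Nonempty ((homologyFunctor A n).obj X ≅ M)) (u : (singleFunctor A n).obj M ⟶ X)
      (v : X ⟶ X'') (w : _ ⟶ _), Triangle.mk u v w ∈ distTriang _ := by
  obtain ⟨X', X'', h', h'', u, v, w, hT⟩ := TStructure.t.exists_triangle X n (n + 1) rfl
  have h1 : X'.IsLE n := ⟨h'⟩
  have h2 : X''.IsGE (n + 1) := ⟨h''⟩
  have h3 : X'.IsGE n := TStructure.t.isGE₂ _ (inv_rot_of_distTriang _ hT) n
    (isGE_shift_of_le X'' (n + 1) (-1) n (by lia)) hX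
  obtain ⟨M, ⟨e⟩⟩ := exists_iso_singleFunctor_obj_of_isGE_of_isLE X' n
  have := isIso_homologyMap_of_triangle' hT n h2
  refine ⟨X'', h2, M, ⟨(asIso ((homologyFunctor A n).map u)).symm ≪≫ (homologyFunctor A n).mapIso e ≪≫
    (singleFunctorCompHomologyFunctorIso A n).app M⟩, e.inv ≫ u, v, w ≫ e.hom⟦(1 : ℤ)⟧', ?_⟩
  refine isomorphic_distinguished _ hT _
    (Triangle.isoMk _ _ e.symm (Iso.refl _) (Iso.refl _) ?_ ?_ ?_)
  · change (e.inv ≫ u) ≫ 𝟙 _ = e.inv ≫ u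
    simp
  · exact (Category.comp_id _).trans (Category.id_comp _).symm
  · change (w ≫ e.hom⟦(1 : ℤ)⟧') ≫ e.inv⟦(1 : ℤ)⟧' = 𝟙 _ ≫ w
    simp [← Functor.map_comp]

variable {B : Type u₂} [Category.{v₂} B] [Abelian B] [HasDerivedCategory.{w'} B]
  {G : A ⥤ B} [G.Additive] [PreservesFiniteLimits G] [PreservesFiniteColimits G]
  [G.Full] [G.Faithful] {t : 𝟭 B ⟶ 𝟭 B}

/-- The only obstruction to descending an extension of `G T` by `G M` is the action of `t`, a
morphism `T ⟶ M`. -/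
theorem fullAt_ext_one (ht : ∀ M : A, t.app (G.obj M) = 0)
    (ht' : ∀ N : B, t.app N = 0 → G.essImage N) {T M : A} (h : ∀ f : T ⟶ M, f = 0) :
    FullAt G.mapDerivedCategory ((singleFunctor A 0).obj T) ((singleFunctor A (-1)).obj M) := by
  have key : FullAt G.mapDerivedCategory ((singleFunctor A 0).obj T)
      (((singleFunctor A 0).obj M)⟦(1 : ℤ)⟧) := fun z =>
    -- With `p = 0` the pushout condition is empty and the condition on `p` becomes the vanishing of
    -- all morphisms `T ⟶ M`.
    exists_lift_of_pushout ht ht' (0 : M ⟶ M) (fun τ _ => h τ) z 0 (by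
      rw [Functor.map_zero, Functor.map_zero, Functor.map_zero, Functor.map_zero, comp_zero])
  exact key.of_iso (Iso.refl _) (((singleFunctors A).shiftIso 1 (-1) 0 (by lia)).app M)

/-- Embed `M` in `I` so that the class becomes the boundary of some `y` in `Ext¹(T, I/M)`. If the
class dies under `G`, then `G y` lifts to an extension of `G T` by `G I`. The action of `t` on it is
a morphism `T ⟶ I` that vanishes in `I/M`, so it lands in `M` and is zero. The extension therefore
descends, `y` lifts to `Ext¹(T, I)`, and its boundary is zero. -/
theorem injAt_ext_two (ht : ∀ M : A, t.app (G.obj M) = 0)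
    (ht' : ∀ N : B, t.app N = 0 → G.essImage N) {T M : A} (h : ∀ f : T ⟶ M, f = 0) :
    InjAt G.mapDerivedCategory ((singleFunctor A 0).obj T)
      (((singleFunctor A (-1)).obj M)⟦(1 : ℤ)⟧) := by
  have key : InjAt G.mapDerivedCategory ((singleFunctor A 0).obj T)
      ((((singleFunctor A 0).obj M)⟦(1 : ℤ)⟧)⟦(1 : ℤ)⟧) := fun g hg => by
    obtain ⟨I, i, _, hi⟩ := exists_mono_effacing T M g
    let S : ShortComplex A := ShortComplex.mk i (cokernel.π i) (cokernel.condition i)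
    have hS : S.ShortExact := { exact := ShortComplex.exact_cokernel i }
    have hT : Triangle.mk ((singleFunctor A 0).map i) ((singleFunctor A 0).map (cokernel.π i))
      hS.singleδ ∈ distTriang _ := hS.singleTriangle_distinguished
    have hT' := dist_shift_one hT
    obtain ⟨y, hy⟩ := dist_lift₁ hT' g (by
      rw [Functor.map_neg, Preadditive.comp_neg, hi, neg_zero])
    obtain ⟨z, hz⟩ := dist_lift₃ (dist_map hT' G.mapDerivedCategory) (G.mapDerivedCategory.map y) (by
      rw [← Category.assoc, ← Functor.map_comp, ← hy, hg, zero_comp])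
    obtain ⟨z', hz'⟩ := exists_lift_of_pushout ht ht' (cokernel.π i) (T := T) (fun τ hτ => by
      have h1 := hS.exact.lift_f τ hτ
      have := hS.mono_f
      rw [← h1, h (hS.exact.lift τ hτ), zero_comp]) (-z) y (by
        rw [Preadditive.neg_comp, hz, Functor.map_neg, Preadditive.comp_neg])
    have h2 := injAt_single_shift_one (G := G) 0 _ _
      (y - z' ≫ ((singleFunctor A 0).map (cokernel.π i))⟦(1 : ℤ)⟧') (by
        rw [Functor.map_sub, Functor.map_comp, hz', hz, Functor.map_neg, Preadditive.comp_neg,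
          Preadditive.neg_comp, sub_self])
    rw [sub_eq_zero] at h2
    have h3 := dist_comp₂₃ hT
    rw [hy, h2, Category.assoc, Preadditive.comp_neg, ← Functor.map_comp, h3, Functor.map_zero,
      neg_zero, comp_zero]
  exact key.of_iso (Iso.refl _) ((shiftFunctor _ (1 : ℤ)).mapIso
    (((singleFunctors A).shiftIso 1 (-1) 0 (by lia)).app M))

/-- `G` is full on morphisms between objects of the tilted heart. -/
theorem fullAt_of_orthogonal (ht : ∀ M : A, t.app (G.obj M) = 0)
    (ht' : ∀ N : B, t.app N = 0 → G.essImage N) {X Y : DerivedCategory A}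
    (hX : X.IsLE 0) (hX' : X.IsGE (-1)) (hY : Y.IsLE 0) (hY' : Y.IsGE (-1))
    (h : ∀ f : (homologyFunctor A 0).obj X ⟶ (homologyFunctor A (-1)).obj Y, f = 0) :
    FullAt G.mapDerivedCategory X Y := by
  obtain ⟨X', h₁, T, ⟨eT⟩, u, v, w, hT⟩ := exists_triangle_top X 0 hX
  obtain ⟨Y'', h₂, M, ⟨eM⟩, a, b, c, hT'⟩ := exists_triangle_bot Y (-1) hY'
  have hTM (f : T ⟶ M) : f = 0 := by
    have := h (eT.hom ≫ f ≫ eM.inv)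
    rw [← cancel_epi eT.hom, ← cancel_mono eM.inv]
    simpa using this
  have h₃ : X'.IsGE (-1) := TStructure.t.isGE₂ _ (inv_rot_of_distTriang _ hT) (-1)
    (isGE_shift_of_le ((singleFunctor A 0).obj T) 0 (-1) (-1) (by lia)) hX'
  have h₄ : Y''.IsLE 0 := TStructure.t.isLE₂ _ (rot_of_distTriang _ hT') 0 hY
    (isLE_shift_of_le ((singleFunctor A (-1)).obj M) (-1) 1 0 (by lia))
  have h₁' : X'.IsLE (-1) := h₁
  have h₂' : Y''.IsGE 0 := h₂
  obtain ⟨M', ⟨eX⟩⟩ := exists_iso_singleFunctor_obj_of_isGE_of_isLE X' (-1)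
  obtain ⟨T', ⟨eY⟩⟩ := exists_iso_singleFunctor_obj_of_isGE_of_isLE Y'' 0
  have full₃ : FullAt G.mapDerivedCategory ((singleFunctor A 0).obj T) Y'' :=
    (fullAt_single 0 T T').of_iso (Iso.refl _) eY.symm
  have inj₁ := injAt_ext_two ht ht' hTM
  -- The three goals: maps out of the degree `-1` part, where there is nothing to hit in degree `0`;
  -- maps from `T` to `Y`, by `Ext¹(T, M)` and `Hom(T, T')`; and injectivity on `Hom(T, Y⟦1⟧)`, by
  -- `Ext²(T, M)` and `Ext¹(T, T')`.
  refine fullAt_of_triangle_src hT ?_ ?_ ?_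
  · refine FullAt.of_iso ?_ eX.symm (Iso.refl _)
    refine fullAt_of_triangle_tgt hT' (fullAt_single _ _ _) (fun f => ⟨0, ?_⟩)
      (injAt_single_shift_one _ _ _)
    have := isLE_mapDerivedCategory G ((singleFunctor A (-1)).obj M') (-1)
    have := isGE_mapDerivedCategory G Y'' 0
    rw [Functor.map_zero]
    exact (hom_eq_zero_of_lt f (-1) 0 (by lia) inferInstance inferInstance).symm
  · exact fullAt_of_triangle_tgt hT' (fullAt_ext_one ht ht' hTM) full₃ inj₁
  · exact injAt_of_triangle_tgt hT' inj₁ ((injAt_single_shift_one 0 T T').of_iso (Iso.refl _)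
      ((shiftFunctor _ (1 : ℤ)).mapIso eY.symm)) full₃

/-- An isomorphism between the images under `G` of two objects of the tilted heart lifts. -/
theorem nonempty_iso_of_map_iso (ht : ∀ M : A, t.app (G.obj M) = 0)
    (ht' : ∀ N : B, t.app N = 0 → G.essImage N) {X Y : DerivedCategory A}
    (hX : X.IsLE 0) (hX' : X.IsGE (-1)) (hY : Y.IsLE 0) (hY' : Y.IsGE (-1))
    (h : ∀ f : (homologyFunctor A 0).obj X ⟶ (homologyFunctor A (-1)).obj Y, f = 0)
    (e : G.mapDerivedCategory.obj X ≅ G.mapDerivedCategory.obj Y) : Nonempty (X ≅ Y) := by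
  obtain ⟨f, hf⟩ := fullAt_of_orthogonal ht ht' hX hX' hY hY' h e.hom
  have : IsIso (G.mapDerivedCategory.map f) := by rw [hf]; infer_instance
  have := isIso_of_isIso_map G f
  exact ⟨asIso f⟩

end HeartFull

/-! ### Periodicity and uniqueness of tilted truncations, tested on images of `D^{≤ n}` -/

section Periodicity

open Pretriangulated DerivedCategory

universe v₁ v₂ u₁ u₂

section

variable {C : Type u₁} [Category.{v₁} C] [Preadditive C] [HasZeroObject C] [HasShift C ℤ]
  [∀ n : ℤ, (shiftFunctor C n).Additive] [Pretriangulated C]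

/-- There is a distinguished triangle `X ⟶ Y ⟶ Z ⟶ X⟦1⟧`. -/
def HasTriangle (X Y Z : C) : Prop :=
  ∃ (u : X ⟶ Y) (v : Y ⟶ Z) (w : Z ⟶ X⟦(1 : ℤ)⟧), Triangle.mk u v w ∈ distTriang C

theorem HasTriangle.shift {X Y Z : C} (h : HasTriangle X Y Z) (n : ℤ) :
    HasTriangle (X⟦n⟧) (Y⟦n⟧) (Z⟦n⟧) := by
  obtain ⟨u, v, w, hT⟩ := h
  exact ⟨_, _, _, Triangle.shift_distinguished _ hT n⟩

/-- Postcomposition with `φ` is bijective on morphisms out of the objects satisfying `P`. -/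
def LocalIso (P : ObjectProperty C) {U V : C} (φ : U ⟶ V) : Prop :=
  ∀ X, P X → Function.Bijective fun f : X ⟶ U => f ≫ φ

variable {P : ObjectProperty C}

theorem LocalIso.of_isIso {U V : C} (φ : U ⟶ V) [IsIso φ] : LocalIso P φ := fun X _ =>
  ⟨fun f g h => (cancel_mono φ).1 h, fun f => ⟨f ≫ inv φ, by simp⟩⟩

theorem LocalIso.comp {U V W : C} {φ : U ⟶ V} {ψ : V ⟶ W} (h : LocalIso P φ) (h' : LocalIso P ψ) :
    LocalIso P (φ ≫ ψ) := fun X hX => by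
  have := (h' X hX).comp (h X hX)
  convert this using 2
  simp

theorem LocalIso.shift {Q : ObjectProperty C} {U V : C} {φ : U ⟶ V} (h : LocalIso P φ) (a : ℤ)
    (hQ : ∀ X, Q X → P (X⟦-a⟧)) : LocalIso Q (φ⟦a⟧') := fun X hX => by
  have hb := h _ (hQ X hX)
  let e : X ≅ (X⟦-a⟧)⟦a⟧ := ((shiftEquiv C a).counitIso.app X).symm
  have key (W : C) (f : X ⟶ W⟦a⟧) : ∃ k : X⟦-a⟧ ⟶ W, f = e.hom ≫ k⟦a⟧' := by
    obtain ⟨k, hk⟩ := (shiftFunctor C a).map_surjective (e.inv ≫ f)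
    exact ⟨k, by rw [hk, e.hom_inv_id_assoc]⟩
  refine ⟨fun f g hfg => ?_, fun f => ?_⟩
  · obtain ⟨f, rfl⟩ := key _ f
    obtain ⟨g, rfl⟩ := key _ g
    dsimp at hfg
    rw [Category.assoc, Category.assoc, cancel_epi, ← Functor.map_comp, ← Functor.map_comp] at hfg
    rw [hb.1 ((shiftFunctor C a).map_injective hfg)]
  · obtain ⟨f, rfl⟩ := key _ f
    obtain ⟨k, rfl⟩ := hb.2 f
    exact ⟨e.hom ≫ k⟦a⟧', by simp⟩

theorem LocalIso.of_triangle {U V W : C} {u : W ⟶ U} {v : U ⟶ V} {w : V ⟶ W⟦(1 : ℤ)⟧}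
    (hT : Triangle.mk u v w ∈ distTriang C) (h₁ : ∀ X, P X → ∀ f : X ⟶ W, f = 0)
    (h₂ : ∀ X, P X → ∀ f : X ⟶ W⟦(1 : ℤ)⟧, f = 0) : LocalIso P v := fun X hX => by
  refine ⟨fun f g hfg => ?_, fun f => ?_⟩
  · obtain ⟨k, hk⟩ := dist_lift₂ hT (f - g) (by rw [Preadditive.sub_comp, sub_eq_zero]; exact hfg)
    rw [← sub_eq_zero, hk, h₁ X hX k, zero_comp]
  · obtain ⟨k, rfl⟩ := dist_lift₃ hT f (h₂ X hX _)
    exact ⟨k, rfl⟩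

/-- Objects representing the same functor on `P` are isomorphic. -/
theorem LocalIso.nonempty_iso {X Y N N' : C} (hX : P X) (hY : P Y) {a : X ⟶ N} {b : Y ⟶ N'}
    {φ : N ⟶ N'} (ha : LocalIso P a) (hb : LocalIso P b) (hφ : LocalIso P φ) :
    Nonempty (X ≅ Y) := by
  have hc := ha.comp hφ
  obtain ⟨f, hf⟩ := (hb X hX).2 (a ≫ φ)
  obtain ⟨g, hg⟩ := (hc Y hY).2 b
  dsimp at hf hg
  exact ⟨⟨f, g, (hc X hX).1 (by simp [hg, hf]), (hb Y hY).1 (by simp [hg, hf])⟩⟩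

end

variable {A : Type u₁} [Category.{v₁} A] [Abelian A] [HasDerivedCategory.{w} A]

/-- `D^{≤ n}` for the tilt at a class `𝒯` of torsion objects. -/
def TiltLE (𝒯 : ObjectProperty A) (n : ℤ) : ObjectProperty (DerivedCategory A) := fun X =>
  X.IsLE n ∧ 𝒯 ((homologyFunctor A n).obj X)

/-- `D^{≥ n}` for the tilt at a class `𝓕` of torsion-free objects. -/
def TiltGE (𝓕 : ObjectProperty A) (n : ℤ) : ObjectProperty (DerivedCategory A) := fun X =>
  X.IsGE (n - 1) ∧ 𝓕 ((homologyFunctor A (n - 1)).obj X)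

variable {𝒯 𝓕 : ObjectProperty A} [𝒯.IsClosedUnderIsomorphisms] [𝓕.IsClosedUnderIsomorphisms]

theorem TiltLE.shift {X : DerivedCategory A} {n : ℤ} (h : TiltLE 𝒯 n X) (a n' : ℤ)
    (hn : a + n' = n) : TiltLE 𝒯 n' (X⟦a⟧) :=
  ⟨have := h.1; TStructure.t.isLE_shift X n a n' hn,
    𝒯.prop_of_iso (((homologyFunctor A 0).shiftIso a n' n hn).app X).symm h.2⟩

theorem TiltGE.shift {X : DerivedCategory A} {n : ℤ} (h : TiltGE 𝓕 n X) (a n' : ℤ)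
    (hn : a + n' = n) : TiltGE 𝓕 n' (X⟦a⟧) :=
  ⟨have := h.1; TStructure.t.isGE_shift X (n - 1) a (n' - 1) (by lia),
    𝓕.prop_of_iso (((homologyFunctor A 0).shiftIso a (n' - 1) (n - 1) (by lia)).app X).symm h.2⟩

variable {B : Type u₂} [Category.{v₂} B] [Abelian B] [HasDerivedCategory.{w'} B]
  {G : A ⥤ B} [G.Additive] [PreservesFiniteLimits G] [PreservesFiniteColimits G]
  [G.Full] [G.Faithful]

/-- Orthogonality of the tilt survives in `D(B)`: apart from degree reasons, a map factors through
the top cohomology of `X` and the bottom one of `Y`, both in degree `n`, and there `G` is fully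
faithful. -/
theorem hom_map_eq_zero (horth : ∀ T M, 𝒯 T → 𝓕 M → ∀ f : T ⟶ M, f = 0) {X Y : DerivedCategory A}
    {n m : ℤ} (hnm : n < m) (hX : TiltLE 𝒯 n X) (hY : TiltGE 𝓕 m Y)
    (f : G.mapDerivedCategory.obj X ⟶ G.mapDerivedCategory.obj Y) : f = 0 := by
  have hLE (n : ℤ) (X : DerivedCategory A) (_ : X.IsLE n) : (G.mapDerivedCategory.obj X).IsLE n :=
    isLE_mapDerivedCategory G X n
  have hGE (n : ℤ) (X : DerivedCategory A) (_ : X.IsGE n) : (G.mapDerivedCategory.obj X).IsGE n :=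
    isGE_mapDerivedCategory G X n
  obtain hm | rfl : n + 1 < m ∨ m = n + 1 := by lia
  · exact hom_eq_zero_of_lt f n (m - 1) (by lia) (hLE _ _ hX.1) (hGE _ _ hY.1)
  obtain ⟨X', h₁, T, ⟨eT⟩, u, v, w, hT⟩ := exists_triangle_top X n hX.1
  obtain ⟨Y', h₂, M, ⟨eM⟩, a, b, c, hT'⟩ := exists_triangle_bot Y n (by simpa using hY.1)
  have hFY : (G.mapDerivedCategory.obj Y).IsGE n := hGE _ _ (by simpa using hY.1)
  obtain ⟨f, rfl⟩ := dist_desc₂ (dist_map hT G.mapDerivedCategory) f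
    (hom_eq_zero_of_lt _ (n - 1) n (by lia) (hLE _ _ h₁) hFY)
  obtain ⟨f, rfl⟩ := dist_lift₂ (dist_map hT' G.mapDerivedCategory) f
    (hom_eq_zero_of_lt _ n (n + 1) (by lia) (hLE _ _ inferInstance) (hGE _ _ h₂))
  obtain ⟨f, rfl⟩ := fullAt_single n T M f
  obtain ⟨f, rfl⟩ := (singleFunctor A n).map_surjective f
  have h𝓕 : 𝓕 ((homologyFunctor A n).obj Y) := by simpa using hY.2
  rw [horth T M (𝒯.prop_of_iso eT hX.2) (𝓕.prop_of_iso eM h𝓕) f, Functor.map_zero,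
    Functor.map_zero, zero_comp, comp_zero]

/-- The images under `G` of the objects of `D^{≤ n}`. -/
def ImageLE (G : A ⥤ B) [G.Additive] [PreservesFiniteLimits G] [PreservesFiniteColimits G]
    (𝒯 : ObjectProperty A) (n : ℤ) : ObjectProperty (DerivedCategory B) := fun Y =>
  ∃ X, TiltLE 𝒯 n X ∧ Nonempty (Y ≅ G.mapDerivedCategory.obj X)

theorem ImageLE.shift {Y : DerivedCategory B} {n : ℤ} (h : ImageLE G 𝒯 n Y) (a n' : ℤ)
    (hn : a + n' = n) : ImageLE G 𝒯 n' (Y⟦a⟧) := by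
  obtain ⟨X, hX, ⟨e⟩⟩ := h
  exact ⟨X⟦a⟧, hX.shift a n' hn, ⟨(shiftFunctor _ a).mapIso e ≪≫
    ((G.mapDerivedCategory.commShiftIso a).symm.app X)⟩⟩

theorem ImageLE.hom_eq_zero (horth : ∀ T M, 𝒯 T → 𝓕 M → ∀ f : T ⟶ M, f = 0)
    {Y : DerivedCategory B} {X : DerivedCategory A} {n m : ℤ} (hnm : n < m) (hY : ImageLE G 𝒯 n Y)
    (hX : TiltGE 𝓕 m X) (f : Y ⟶ G.mapDerivedCategory.obj X) : f = 0 := by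
  obtain ⟨Z, hZ, ⟨e⟩⟩ := hY
  rw [← cancel_epi e.inv, hom_map_eq_zero horth hnm hZ hX (e.inv ≫ f), comp_zero]

/-- Truncation triangles are sent by `G` to local isomorphisms. -/
theorem localIso_map_of_triangle (horth : ∀ T M, 𝒯 T → 𝓕 M → ∀ f : T ⟶ M, f = 0)
    {X E Z : DerivedCategory A} {n : ℤ} (hZ : TiltGE 𝓕 (n + 1) Z) {u : X ⟶ E} {v : E ⟶ Z}
    {w : Z ⟶ X⟦(1 : ℤ)⟧} (hT : Triangle.mk u v w ∈ distTriang _) :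
    LocalIso (ImageLE G 𝒯 n) (G.mapDerivedCategory.map u) := by
  have hT' := dist_map hT G.mapDerivedCategory
  intro Y hY
  refine ⟨fun f g hfg => ?_, fun f => ?_⟩
  · obtain ⟨k, hk⟩ := dist_lift₁ hT' ((f - g)⟦(1 : ℤ)⟧') (by
      rw [← Functor.map_comp, Preadditive.sub_comp, sub_eq_zero.2 hfg, Functor.map_zero])
    rw [ImageLE.hom_eq_zero horth (by lia) (hY.shift 1 (n - 1) (by lia)) hZ k, zero_comp] at hk
    exact sub_eq_zero.1 ((shiftFunctor _ (1 : ℤ)).map_injective (by rw [hk, Functor.map_zero]))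
  · obtain ⟨k, rfl⟩ := dist_lift₂ hT' f (hY.hom_eq_zero horth (by lia) hZ _)
    exact ⟨k, rfl⟩

/-- The comparison `N ⟶ N⟦2r⟧` of a periodic object. -/
theorem exists_periodicity (horth : ∀ T M, 𝒯 T → 𝓕 M → ∀ f : T ⟶ M, f = 0)
    {A₀ : DerivedCategory A} (hA : TiltGE 𝓕 0 A₀) {N P J : DerivedCategory B}
    (eP : P ≅ G.mapDerivedCategory.obj A₀) (h₁ : HasTriangle N P J) (h₂ : HasTriangle J P N)
    (r : ℕ) : ∃ φ : N ⟶ N⟦(2 * r : ℤ)⟧, ∀ i : ℤ, i ≤ -1 - 2 * r → LocalIso (ImageLE G 𝒯 i) φ := by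
  have hP (s i : ℤ) (his : i + s < 0) (Y : DerivedCategory B) (hY : ImageLE G 𝒯 i Y)
      (f : Y ⟶ P⟦s⟧) : f = 0 := by
    let e := (shiftFunctor _ s).mapIso eP ≪≫ ((G.mapDerivedCategory.commShiftIso s).symm.app A₀)
    rw [← cancel_mono e.hom, hY.hom_eq_zero horth (m := -s) (by lia) (hA.shift s (-s) (by lia))
      (f ≫ e.hom), zero_comp]
  have hP0 (i : ℤ) (hi : i < 0) (Y : DerivedCategory B) (hY : ImageLE G 𝒯 i Y)
      (f : Y ⟶ P) : f = 0 := by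
    rw [← cancel_mono eP.hom, hY.hom_eq_zero horth hi hA (f ≫ eP.hom), zero_comp]
  obtain ⟨u₁, v₁, δ₁, hT₁⟩ := h₁
  obtain ⟨u₂, v₂, δ₂, hT₂⟩ := h₂
  -- Test objects must see neither `P` nor `P⟦1⟧`; the latter forces `i + 1 < 0`.
  have b₁ (i : ℤ) (hi : i ≤ -2) : LocalIso (ImageLE G 𝒯 i) δ₁ :=
    LocalIso.of_triangle (rot_of_distTriang _ hT₁) (hP0 i (by lia)) (hP 1 i (by lia))
  have b₂ (i : ℤ) (hi : i ≤ -2) : LocalIso (ImageLE G 𝒯 i) δ₂ :=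
    LocalIso.of_triangle (rot_of_distTriang _ hT₂) (hP0 i (by lia)) (hP 1 i (by lia))
  have hshift {U V : DerivedCategory B} {φ : U ⟶ V} (a i : ℤ) (h : LocalIso (ImageLE G 𝒯 (i + a)) φ) :
      LocalIso (ImageLE G 𝒯 i) (φ⟦a⟧') :=
    h.shift a fun X hX => hX.shift _ _ (by lia)
  induction r with
  | zero =>
    exact ⟨(shiftFunctorZero' _ (2 * (0 : ℕ) : ℤ) (by simp)).inv.app N, fun i _ => LocalIso.of_isIso _⟩
  | succ r ih =>
    obtain ⟨φ, hφ⟩ := ih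
    let e := (shiftFunctorAdd' (DerivedCategory B) (1 : ℤ) 1 2 (by lia)).app N
    let e' := (shiftFunctorAdd' (DerivedCategory B) (2 * r : ℤ) 2 (2 * (r + 1 : ℕ) : ℤ) (by push_cast; lia)).app N
    -- One period is `N ⟶ J⟦1⟧ ⟶ N⟦2⟧`. Shifting by `a` moves the test range down by `a`, so each
    -- period lowers the bound on `i` by two.
    refine ⟨(δ₂ ≫ δ₁⟦(1 : ℤ)⟧' ≫ e.inv) ≫ φ⟦(2 : ℤ)⟧' ≫ e'.inv, fun i hi => ?_⟩
    push_cast at hi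
    exact (((b₂ i (by lia)).comp ((hshift 1 i (b₁ _ (by lia))).comp (LocalIso.of_isIso _)))).comp
      ((hshift 2 i (hφ _ (by lia))).comp (LocalIso.of_isIso _))

/-- Uniqueness of the top tilted cohomology, after applying `G`. -/
theorem nonempty_iso_of_triangles (horth : ∀ T M, 𝒯 T → 𝓕 M → ∀ f : T ⟶ M, f = 0)
    {n : ℤ} {Z X V Z' X' V' : DerivedCategory A} (hZ : TiltLE 𝒯 (n - 1) Z) (hV : TiltGE 𝓕 n V)
    (hZ' : TiltLE 𝒯 (n - 1) Z') (hV' : TiltGE 𝓕 n V') (h : HasTriangle Z X V)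
    (h' : HasTriangle Z' X' V') (e : G.mapDerivedCategory.obj X ≅ G.mapDerivedCategory.obj X') :
    Nonempty (G.mapDerivedCategory.obj V ≅ G.mapDerivedCategory.obj V') := by
  obtain ⟨u, q, w, hT⟩ := h
  obtain ⟨u', q', w', hT'⟩ := h'
  -- Factorisations through the image of `q` are unique because the image of `Z⟦1⟧` has no maps to
  -- that of `V`.
  have uniq {Z X V : DerivedCategory A} {u : Z ⟶ X} {q : X ⟶ V} {w : V ⟶ Z⟦(1 : ℤ)⟧}
      (hT : Triangle.mk u q w ∈ distTriang _) (hZ : TiltLE 𝒯 (n - 1) Z) (hV : TiltGE 𝓕 n V)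
      (x y : G.mapDerivedCategory.obj V ⟶ G.mapDerivedCategory.obj V)
      (hx : G.mapDerivedCategory.map q ≫ x = G.mapDerivedCategory.map q ≫ y) : x = y := by
    obtain ⟨k, hk⟩ := dist_desc₃ (dist_map hT G.mapDerivedCategory) (x - y) (by
      rw [Preadditive.comp_sub, hx, sub_self])
    have hZ1 : ImageLE G 𝒯 (n - 2) ((G.mapDerivedCategory.obj Z)⟦(1 : ℤ)⟧) :=
      ImageLE.shift ⟨Z, hZ, ⟨Iso.refl _⟩⟩ 1 (n - 2) (by lia)
    rw [hZ1.hom_eq_zero horth (by lia) hV k, comp_zero] at hk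
    exact sub_eq_zero.1 hk
  obtain ⟨f, hf⟩ := dist_desc₂ (dist_map hT G.mapDerivedCategory)
    (e.hom ≫ G.mapDerivedCategory.map q') (hom_map_eq_zero horth (by lia) hZ hV' _)
  obtain ⟨g, hg⟩ := dist_desc₂ (dist_map hT' G.mapDerivedCategory)
    (e.inv ≫ G.mapDerivedCategory.map q) (hom_map_eq_zero horth (by lia) hZ' hV _)
  refine ⟨⟨f, g, uniq hT hZ hV _ _ ?_, uniq hT' hZ' hV' _ _ ?_⟩⟩
  · rw [← Category.assoc, ← hf, Category.assoc, ← hg, e.hom_inv_id_assoc, Category.comp_id]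
  · rw [← Category.assoc, ← hg, Category.assoc, ← hf, e.inv_hom_id_assoc, Category.comp_id]

/-- Two tilted cohomology objects in degrees `j - 2r ≤ j < 0` of an object whose image under `G` is
periodic up to `G A₀`, with `A₀` in the tilted `D^{≥ 0}`, are isomorphic. -/
theorem nonempty_iso_of_periodicity {t : 𝟭 B ⟶ 𝟭 B} (ht : ∀ M : A, t.app (G.obj M) = 0)
    (ht' : ∀ N : B, t.app N = 0 → G.essImage N)
    (horth : ∀ T M, 𝒯 T → 𝓕 M → ∀ f : T ⟶ M, f = 0)
    {A₀ E : DerivedCategory A} (hA : TiltGE 𝓕 0 A₀) {P J : DerivedCategory B}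
    (eP : P ≅ G.mapDerivedCategory.obj A₀) (h₁ : HasTriangle (G.mapDerivedCategory.obj E) P J)
    (h₂ : HasTriangle J P (G.mapDerivedCategory.obj E)) {i j : ℤ} (r : ℕ) (hij : i + 2 * r = j)
    (hj : j < 0) {X Y Z Z' W W' V V' : DerivedCategory A}
    (hX : TiltLE 𝒯 i X) (hZ : TiltGE 𝓕 (i + 1) Z) (hXZ : HasTriangle X E Z)
    (hW : TiltLE 𝒯 (i - 1) W) (hVi : TiltGE 𝓕 i (V⟦-i⟧)) (hWX : HasTriangle W X (V⟦-i⟧))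
    (hY : TiltLE 𝒯 j Y) (hZ' : TiltGE 𝓕 (j + 1) Z') (hYZ : HasTriangle Y E Z')
    (hW' : TiltLE 𝒯 (j - 1) W') (hVj : TiltGE 𝓕 j (V'⟦-j⟧)) (hWY : HasTriangle W' Y (V'⟦-j⟧))
    (hV : TiltLE 𝒯 0 V) (hV₁ : TiltGE 𝓕 0 V) (hV' : TiltLE 𝒯 0 V') (hV₁' : TiltGE 𝓕 0 V') :
    Nonempty (V ≅ V') := by
  obtain ⟨φ, hφ⟩ := exists_periodicity horth hA eP h₁ h₂ r
  obtain ⟨u, v, w, hT⟩ := hXZ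
  obtain ⟨u', v', w', hT'⟩ := hYZ.shift (2 * r)
  have hY2 := hY.shift (2 * r) i (by lia)
  -- `Y⟦2r⟧` is the truncation `τ^{≤ i}` of `E⟦2r⟧`, so after `G` it represents the same functor on
  -- test objects as `X = τ^{≤ i} E`.
  obtain ⟨e⟩ := LocalIso.nonempty_iso (P := ImageLE G 𝒯 i)
    (X := G.mapDerivedCategory.obj X) (Y := G.mapDerivedCategory.obj (Y⟦(2 * r : ℤ)⟧))
    ⟨X, hX, ⟨Iso.refl _⟩⟩ ⟨_, hY2, ⟨Iso.refl _⟩⟩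
    (localIso_map_of_triangle horth hZ hT)
    (localIso_map_of_triangle horth (hZ'.shift (2 * r) (i + 1) (by lia)) hT')
    ((hφ i (by lia)).comp
      (LocalIso.of_isIso ((G.mapDerivedCategory.commShiftIso (2 * r : ℤ)).inv.app E)))
  obtain ⟨e'⟩ := nonempty_iso_of_triangles horth hW hVi (hW'.shift (2 * r) (i - 1) (by lia))
    (hVj.shift (2 * r) i (by lia)) hWX (hWY.shift (2 * r)) e
  have e₁ : G.mapDerivedCategory.obj V ≅ (G.mapDerivedCategory.obj (V⟦-i⟧))⟦i⟧ :=
    G.mapDerivedCategory.mapIso ((shiftEquiv _ i).counitIso.app V).symm ≪≫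
      (G.mapDerivedCategory.commShiftIso i).app _
  have e₂ : G.mapDerivedCategory.obj V' ≅ (G.mapDerivedCategory.obj ((V'⟦-j⟧)⟦(2 * r : ℤ)⟧))⟦i⟧ :=
    G.mapDerivedCategory.mapIso ((shiftFunctorZero' _ (0 : ℤ) rfl).symm.app V' ≪≫
      (shiftFunctorAdd' _ (-j + 2 * r) i 0 (by lia)).app V' ≪≫
      (shiftFunctor _ i).mapIso ((shiftFunctorAdd' _ (-j) (2 * r) (-j + 2 * r) rfl).app V')) ≪≫
      (G.mapDerivedCategory.commShiftIso i).app _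
  exact nonempty_iso_of_map_iso ht ht' hV.1 hV₁.1 hV'.1 hV₁'.1
    (horth _ _ hV.2 hV₁'.2) (e₁ ≪≫ (shiftFunctor _ i).mapIso e' ≪≫ e₂.symm)

end Periodicity

/-! ### The two triangles of a complex with periodic multiplications -/

section FlatComplex

open DerivedCategory Pretriangulated

universe v₁ v₂ u₁ u₂

/-- A complex `K → K → K` exact in the middle both ways round resolves the cokernel periodically. -/
theorem exists_shortExact_of_periodic {C : Type u₁} [Category.{v₁} C] [Abelian C] {K N : C}
    {t t' : K ⟶ K} {η : K ⟶ N} (h₀ : t ≫ t' = 0) (h₀' : t' ≫ t = 0) (hη₀ : t ≫ η = 0)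
    (h : (ShortComplex.mk t t' h₀).Exact) (h' : (ShortComplex.mk t' t h₀').Exact)
    (hη : (ShortComplex.mk t η hη₀).Exact) [Epi η] :
    ∃ (J : C) (ι : J ⟶ K) (q : K ⟶ J) (m : N ⟶ K) (h₁ : ι ≫ η = 0) (h₂ : m ≫ q = 0),
      (ShortComplex.mk ι η h₁).ShortExact ∧ (ShortComplex.mk m q h₂).ShortExact := by
  -- `J` is `ker η = im t`. The map `t` induces the quotient `q : K ⟶ J`, while `t'` induces `m`,
  -- which identifies `N = coker t` with `im t' = ker t`.
  let q : K ⟶ kernel η := kernel.lift η t hη₀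
  have : Epi q := (ShortComplex.exact_iff_epi_kernel_lift _).1 hη
  have hq : q ≫ kernel.ι η = t := kernel.lift_ι _ _ _
  let m : N ⟶ K := hη.desc t' h₀
  have hm : η ≫ m = t' := hη.g_desc t' h₀
  have h₂ : m ≫ q = 0 := by
    rw [← cancel_mono (kernel.ι η), ← cancel_epi η, Category.assoc, hq, zero_comp, comp_zero,
      ← Category.assoc, hm, h₀']
  have : Mono m := Preadditive.mono_of_cancel_zero _ fun {W} x hx => by
    obtain ⟨W', π, hπ, y, hy⟩ := surjective_up_to_refinements_of_epi η x
    obtain ⟨W'', π', hπ', z, hz⟩ := h.exact_up_to_refinements y (by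
      change y ≫ t' = 0
      rw [← hm, ← Category.assoc, ← hy, Category.assoc, hx, comp_zero])
    change π' ≫ y = z ≫ t at hz
    rw [← cancel_epi π, ← cancel_epi π', hy, ← Category.assoc, hz, Category.assoc, hη₀]
    simp
  refine ⟨_, kernel.ι η, q, m, kernel.condition η, h₂, ⟨?_⟩, ⟨?_⟩⟩
  · exact ShortComplex.exact_of_f_is_kernel _ (kernelIsKernel η)
  · rw [ShortComplex.exact_iff_exact_up_to_refinements]
    intro W x hx
    change x ≫ q = 0 at hx
    obtain ⟨W', π, hπ, y, hy⟩ := h'.exact_up_to_refinements x (by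
      change x ≫ t = 0
      rw [← hq, ← Category.assoc, hx, zero_comp])
    exact ⟨W', π, hπ, y ≫ η, by rw [hy, Category.assoc]; change y ≫ t' = y ≫ η ≫ m; rw [hm]⟩

theorem HasTriangle.of_iso {C : Type u₁} [Category.{v₁} C] [Preadditive C] [HasZeroObject C]
    [HasShift C ℤ] [∀ n : ℤ, (shiftFunctor C n).Additive] [Pretriangulated C] {X Y Z X' Z' : C}
    (h : HasTriangle X Y Z) (e : X ≅ X') (e' : Z ≅ Z') : HasTriangle X' Y Z' := by
  obtain ⟨u, v, w, hT⟩ := h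
  refine ⟨e.inv ≫ u, v ≫ e'.hom, e'.inv ≫ w ≫ e.hom⟦(1 : ℤ)⟧', isomorphic_distinguished _ hT _
    (Triangle.isoMk (Triangle.mk _ _ _) (Triangle.mk u v w) e.symm (Iso.refl _) e'.symm ?_ ?_ ?_)⟩
  · exact Category.comp_id _
  · change (v ≫ e'.hom) ≫ e'.inv = 𝟙 Y ≫ v
    simp
  · change (e'.inv ≫ w ≫ e.hom⟦(1 : ℤ)⟧') ≫ e.inv⟦(1 : ℤ)⟧' = e'.inv ≫ w
    simp [← Functor.map_comp]

variable {A : Type u₁} [Category.{v₁} A] [Abelian A]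
  {B : Type u₂} [Category.{v₂} B] [Abelian B] {L : B ⥤ A} {G : A ⥤ B} [G.Full] [G.Faithful]

/-- The unit of the reflection onto the objects killed by `t` is the cokernel of `t`. -/
theorem exact_unit_of_adjunction (adj : L ⊣ G) {t : 𝟭 B ⟶ 𝟭 B} (ht : ∀ M : A, t.app (G.obj M) = 0)
    (ht' : ∀ N : B, t.app N = 0 → G.essImage N) (M : B) :
    ∃ h : t.app M ≫ adj.unit.app M = 0,
      (ShortComplex.mk (t.app M) (adj.unit.app M) h).Exact ∧ Epi (adj.unit.app M) := by
  have h : t.app M ≫ adj.unit.app M = 0 := by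
    have := t.naturality (adj.unit.app M)
    simp only [Functor.id_obj, Functor.id_map, Functor.comp_obj] at this
    rw [← this, ht, comp_zero]
  let c := cokernel.π (t.app M)
  -- The cokernel of `t` is killed by `t`, hence lies in the image of `G`; the universal property of
  -- the unit then compares it with the reflection.
  have hc : t.app (cokernel (t.app M)) = 0 := by
    have := t.naturality c
    simp only [Functor.id_obj, Functor.id_map] at this
    rw [← cancel_epi c, this, cokernel.condition, comp_zero]
  obtain ⟨C', ⟨e⟩⟩ := ht' _ hc
  let d : cokernel (t.app M) ⟶ G.obj (L.obj M) := cokernel.desc _ (adj.unit.app M) h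
  let d' : G.obj (L.obj M) ⟶ cokernel (t.app M) :=
    G.map ((adj.homEquiv M C').symm (c ≫ e.inv)) ≫ e.hom
  have hd : c ≫ d = adj.unit.app M := cokernel.π_desc _ _ _
  have hd' : adj.unit.app M ≫ d' = c := by
    have := (adj.homEquiv M C').apply_symm_apply (c ≫ e.inv)
    rw [adj.homEquiv_unit] at this
    rw [← Category.assoc, this, Category.assoc, e.inv_hom_id, Category.comp_id]
  have h₁ : d ≫ d' = 𝟙 _ := by rw [← cancel_epi c, ← Category.assoc, hd, hd', Category.comp_id]
  have h₂ : d' ≫ d = 𝟙 _ := by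
    obtain ⟨f, hf⟩ := G.map_surjective (d' ≫ d)
    rw [← hf, ← G.map_id]
    congr 1
    apply (adj.homEquiv _ _).injective
    rw [adj.homEquiv_unit, adj.homEquiv_unit, hf, ← Category.assoc, hd', hd, G.map_id]
    exact (Category.comp_id _).symm
  have : IsIso d := ⟨d', h₁, h₂⟩
  have : Epi (adj.unit.app M) := by rw [← hd]; infer_instance
  refine ⟨h, ?_, this⟩
  refine (ShortComplex.exact_iff_of_iso (ShortComplex.isoMk (S₁ := ShortComplex.mk (t.app M) c
    (cokernel.condition _)) (S₂ := ShortComplex.mk (t.app M) (adj.unit.app M) h)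
    (Iso.refl _) (Iso.refl _) (asIso d) ?_ ?_)).1
    (ShortComplex.exact_of_g_is_cokernel _ (cokernelIsCokernel _))
  · simp
  · simp [hd]

theorem exact_complex {K₁ K₂ K₃ : CochainComplex B ℤ} {f : K₁ ⟶ K₂} {g : K₂ ⟶ K₃} (h : f ≫ g = 0)
    (hex : ∀ n, ∃ h' : f.f n ≫ g.f n = 0, (ShortComplex.mk (f.f n) (g.f n) h').Exact) :
    (ShortComplex.mk f g h).Exact :=
  HomologicalComplex.exact_of_degreewise_exact _ fun n => (hex n).2

/-- A complex on which `t` and `t'` are exact is an extension, both ways round, of its reflection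
by a complex `J`. -/
theorem exists_hasTriangle_of_adjunction [G.Additive] [L.Additive] [PreservesFiniteLimits G]
    [PreservesFiniteColimits G] [HasDerivedCategory.{w} A] [HasDerivedCategory.{w'} B]
    (adj : L ⊣ G) {t t' : 𝟭 B ⟶ 𝟭 B}
    (ht : ∀ M : A, t.app (G.obj M) = 0) (ht' : ∀ N : B, t.app N = 0 → G.essImage N)
    (K : CochainComplex B ℤ)
    (h : ∀ n, ∃ h : t.app (K.X n) ≫ t'.app (K.X n) = 0,
      (ShortComplex.mk (t.app (K.X n)) (t'.app (K.X n)) h).Exact)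
    (h' : ∀ n, ∃ h : t'.app (K.X n) ≫ t.app (K.X n) = 0,
      (ShortComplex.mk (t'.app (K.X n)) (t.app (K.X n)) h).Exact)
    {E : DerivedCategory A}
    (e : E ≅ Q.obj ((L.mapHomologicalComplex (ComplexShape.up ℤ)).obj K)) :
    ∃ J : DerivedCategory B, HasTriangle (G.mapDerivedCategory.obj E) (Q.obj K) J ∧
      HasTriangle J (Q.obj K) (G.mapDerivedCategory.obj E) := by
  let N : CochainComplex B ℤ := (G.mapHomologicalComplex _).obj ((L.mapHomologicalComplex _).obj K)
  let η : K ⟶ N :=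
    { f n := adj.unit.app (K.X n)
      comm' i j _ := (adj.unit.naturality (K.d i j)).symm }
  have hη (n : ℤ) := exact_unit_of_adjunction adj ht ht' (K.X n)
  have : Epi η := by
    have (n : ℤ) : Epi (η.f n) := (hη n).2.2
    exact HomologicalComplex.epi_of_epi_f _ this
  have h₀ : (complexEnd t).app K ≫ (complexEnd t').app K = 0 := by
    ext n; exact (h n).1
  have h₀' : (complexEnd t').app K ≫ (complexEnd t).app K = 0 := by
    ext n; exact (h' n).1
  have h₀'' : (complexEnd t).app K ≫ η = 0 := by
    ext n; exact (hη n).1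
  obtain ⟨J, ι, q, m, h₁, h₂, hs₁, hs₂⟩ := exists_shortExact_of_periodic h₀ h₀' h₀''
    (exact_complex _ h) (exact_complex _ h') (exact_complex _ fun n => ⟨(hη n).1, (hη n).2.1⟩)
  let e' : G.mapDerivedCategory.obj E ≅ Q.obj N :=
    G.mapDerivedCategory.mapIso e ≪≫ G.mapDerivedCategoryFactors.app _
  have H₁ : HasTriangle (Q.obj J) (Q.obj K) (Q.obj N) := ⟨_, _, _, triangleOfSES_distinguished hs₁⟩
  have H₂ : HasTriangle (Q.obj N) (Q.obj K) (Q.obj J) := ⟨_, _, _, triangleOfSES_distinguished hs₂⟩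
  exact ⟨Q.obj J, H₂.of_iso e'.symm (Iso.refl _), H₁.of_iso (Iso.refl _) e'.symm⟩

end FlatComplex

/-! ### Sections of modules, gluing, and multiplication by a global section -/

section Sections

variable {Y Z : Scheme.{u}}

/-- Restriction of sections of the structure sheaf. -/
noncomputable def resO {U W : Z.Opens} (h : W ≤ U) : Γ(Z, U) →+* Γ(Z, W) :=
  (Z.presheaf.map (homOfLE h).op).hom

/-- Restriction of sections of a module. -/
noncomputable def res (M : Z.Modules) {U W : Z.Opens} (h : W ≤ U) : Γ(M, U) →+ Γ(M, W) :=
  (M.presheaf.map (homOfLE h).op).hom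

theorem resO_resO {U V W : Z.Opens} (h : V ≤ U) (h' : W ≤ V) (s : Γ(Z, U)) :
    resO h' (resO h s) = resO (h'.trans h) s :=
  (ConcreteCategory.congr_hom (Z.presheaf.map_comp (homOfLE h).op (homOfLE h').op) s).symm

theorem resO_self {U : Z.Opens} (h : U ≤ U) (s : Γ(Z, U)) : resO h s = s :=
  ConcreteCategory.congr_hom (Z.presheaf.map_id _) s

theorem res_res (M : Z.Modules) {U V W : Z.Opens} (h : V ≤ U) (h' : W ≤ V) (x : Γ(M, U)) :
    res M h' (res M h x) = res M (h'.trans h) x :=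
  (ConcreteCategory.congr_hom (M.presheaf.map_comp (homOfLE h).op (homOfLE h').op) x).symm

theorem res_self (M : Z.Modules) {U : Z.Opens} (h : U ≤ U) (x : Γ(M, U)) : res M h x = x :=
  ConcreteCategory.congr_hom (M.presheaf.map_id _) x

theorem res_smul (M : Z.Modules) {U W : Z.Opens} (h : W ≤ U) (s : Γ(Z, U)) (x : Γ(M, U)) :
    res M h (s • x) = resO h s • res M h x :=
  M.map_smul (homOfLE h) s x

theorem res_app {M N : Z.Modules} (φ : M ⟶ N) {U W : Z.Opens} (h : W ≤ U) (x : Γ(M, U)) :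
    φ.app W (res M h x) = res N h (φ.app U x) :=
  ConcreteCategory.congr_hom (φ.mapPresheaf.naturality (homOfLE h).op) x

theorem app_resO (f : Y ⟶ Z) {U W : Z.Opens} (h : W ≤ U) (s : Γ(Z, U)) :
    f.app W (resO h s) = resO (f.preimage_mono h) (f.app U s) :=
  ConcreteCategory.congr_hom (f.naturality (homOfLE h).op) s

/-- Sections of a module that agree locally are equal. -/
theorem eq_of_locally_eq (M : Z.Modules) {U : Z.Opens} {x y : Γ(M, U)}
    (H : ∀ z ∈ U, ∃ (W : Z.Opens) (h : W ≤ U), z ∈ W ∧ res M h x = res M h y) : x = y := by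
  choose W hW hz hxy using H
  refine TopCat.Sheaf.eq_of_locally_eq' ((toAbSheaf Z).obj M) (fun z : U => W z z.2) U
    (fun z => homOfLE (hW z z.2)) (fun z hzU => ?_) x y (fun z => hxy z z.2)
  exact TopologicalSpace.Opens.mem_iSup.2 ⟨⟨z, hzU⟩, hz z hzU⟩

/-- Compatible local sections of a module glue. -/
theorem exists_gluing (M : Z.Modules) {U : Z.Opens} {ι : Type*} (W : ι → Z.Opens)
    (hW : ∀ i, W i ≤ U) (hU : ∀ z ∈ U, ∃ i, z ∈ W i) (x : ∀ i, Γ(M, W i))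
    (hx : ∀ i j (V : Z.Opens) (hi : V ≤ W i) (hj : V ≤ W j), res M hi (x i) = res M hj (x j)) :
    ∃ y : Γ(M, U), ∀ i, res M (hW i) y = x i := by
  obtain ⟨y, hy, -⟩ := TopCat.Sheaf.existsUnique_gluing' ((toAbSheaf Z).obj M) W U
    (fun i => homOfLE (hW i)) (fun z hz => TopologicalSpace.Opens.mem_iSup.2 (hU z hz)) x
    (fun i j => hx i j _ inf_le_left inf_le_right)
  exact ⟨y, hy⟩

/-- A morphism of modules from an additive natural family of linear maps. -/
noncomputable def homMk {M N : Z.Modules} (φ : ∀ U : Z.Opens, Γ(M, U) →+ Γ(N, U))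
    (h : ∀ {U W : Z.Opens} (h : W ≤ U) (x : Γ(M, U)), φ W (res M h x) = res N h (φ U x))
    (hs : ∀ (U : Z.Opens) (s : Γ(Z, U)) (x : Γ(M, U)), φ U (s • x) = s • φ U x) : M ⟶ N :=
  SheafOfModules.Hom.mk (PresheafOfModules.homMk (M₁ := M.val) (M₂ := N.val)
    { app U := AddCommGrpCat.ofHom (φ U.unop)
      naturality U W i := by
        ext x
        exact h i.unop.le x }
    fun U s x => hs U.unop s x)

theorem modules_hom_ext {M N : Z.Modules} {φ ψ : M ⟶ N}
    (h : ∀ (U : Z.Opens) (x : Γ(M, U)), φ.app U x = ψ.app U x) : φ = ψ :=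
  Scheme.Modules.hom_ext _ _ fun U => by ext x; exact h U x

theorem hom_app_congr {M N : Z.Modules} {φ ψ : M ⟶ N} (h : φ = ψ) (U : Z.Opens) (x : Γ(M, U)) :
    φ.app U x = ψ.app U x := by rw [h]

/-- Multiplication by a global section as an endomorphism of the identity functor. -/
noncomputable def mulEnd (a : Γ(Z, ⊤)) : 𝟭 Z.Modules ⟶ 𝟭 Z.Modules where
  app M := homMk (fun U => DistribSMul.toAddMonoidHom _ (resO le_top a : Γ(Z, U)))
    (fun {U W} h x => by
      change (resO _ a : Γ(Z, W)) • res M h x = res M h ((resO _ a : Γ(Z, U)) • x)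
      rw [res_smul, resO_resO])
    (fun U s x => by
      change (resO _ a : Γ(Z, U)) • s • x = s • (resO _ a : Γ(Z, U)) • x
      rw [smul_smul, smul_smul, mul_comm])
  naturality M N φ := modules_hom_ext fun U x => by
    change (resO _ a : Γ(Z, U)) • φ.app U x = φ.app U ((resO _ a : Γ(Z, U)) • x)
    rw [Scheme.Modules.Hom.app_smul]

theorem mulEnd_app_app (a : Γ(Z, ⊤)) (M : Z.Modules) (U : Z.Opens) (x : Γ(M, U)) :
    ((mulEnd a).app M).app U x = (resO le_top a : Γ(Z, U)) • x := rfl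

end Sections

/-! ### Modules killed by `a` are the pushforwards -/

section Thickening

variable {Y Z : Scheme.{u}}

/-- `f` is a surjective closed immersion whose ideal is locally generated by the global section
`a`, expressed on local sections. -/
structure IsLocallyCutOut (f : Y ⟶ Z) (a : Γ(Z, ⊤)) : Prop where
  surjective : Function.Surjective f
  app_eq_zero : f.app ⊤ a = 0
  exists_lift : ∀ (U : Z.Opens) (r : Γ(Y, f ⁻¹ᵁ U)), ∀ z ∈ U, ∃ (W : Z.Opens) (h : W ≤ U), z ∈ W ∧
    ∃ s : Γ(Z, W), f.app W s = resO (f.preimage_mono h) r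
  exists_dvd : ∀ (U : Z.Opens) (s : Γ(Z, U)), f.app U s = 0 → ∀ z ∈ U, ∃ (W : Z.Opens) (h : W ≤ U),
    z ∈ W ∧ ∃ c : Γ(Z, W), resO h s = resO le_top a * c

variable (f : Y ⟶ Z) [IsClosedImmersion f]

/-- The largest open subset with given preimage under a closed immersion. -/
def imageOpens (V : Y.Opens) : Z.Opens := f.isClosedEmbedding.isInducing.functorObj V

@[simp]
theorem preimage_imageOpens (V : Y.Opens) : f ⁻¹ᵁ imageOpens f V = V :=
  f.isClosedEmbedding.isInducing.map_functorObj V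

theorem imageOpens_mono {V V' : Y.Opens} (h : V ≤ V') : imageOpens f V ≤ imageOpens f V' :=
  f.isClosedEmbedding.isInducing.le_functorObj_iff.2 ((preimage_imageOpens f V).trans_le h)

variable {f}

theorem preimage_le_of_le_imageOpens {W : Z.Opens} {V : Y.Opens} (h : W ≤ imageOpens f V) :
    f ⁻¹ᵁ W ≤ V :=
  f.isClosedEmbedding.isInducing.le_functorObj_iff.1 h

theorem imageOpens_preimage_le (hf : Function.Surjective f) (U : Z.Opens) :
    imageOpens f (f ⁻¹ᵁ U) ≤ U := fun z hz => by
  obtain ⟨y, rfl⟩ := hf z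
  exact f.isClosedEmbedding.isInducing.mem_functorObj_iff _ |>.1 hz

theorem le_imageOpens_preimage (U : Z.Opens) : U ≤ imageOpens f (f ⁻¹ᵁ U) :=
  f.isClosedEmbedding.isInducing.le_functorObj_iff.2 le_rfl

theorem pushforward_smul (M : Y.Modules) {U : Z.Opens} (s : Γ(Z, U))
    (x : Γ((Scheme.Modules.pushforward f).obj M, U)) :
    s • x = (f.app U s • (show Γ(M, f ⁻¹ᵁ U) from x) : Γ(M, f ⁻¹ᵁ U)) := rfl

namespace IsLocallyCutOut

variable {a : Γ(Z, ⊤)}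

/-- Every open of `Y` is the preimage of `imageOpens f V`, which defines the lift on sections.
Sections of `𝒪_Y` lift locally to `𝒪_Z`, so `𝒪_Z`-linearity forces `𝒪_Y`-linearity. -/
theorem pushforward_full (hf : IsLocallyCutOut f a) : (Scheme.Modules.pushforward f).Full where
  map_surjective {M N} ψ := by
    let χ (V : Y.Opens) : Γ(M, V) →+ Γ(N, V) :=
      (res N (preimage_imageOpens f V).ge).comp
        ((ψ.app (imageOpens f V)).hom.comp (res M (preimage_imageOpens f V).le))
    have hχ (V : Y.Opens) (W : Z.Opens) (h : f ⁻¹ᵁ W ≤ V) (x : Γ(M, V)) :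
        res N h (χ V x) = ψ.app W (res M h x) := by
      have hW : W ≤ imageOpens f V := f.isClosedEmbedding.isInducing.le_functorObj_iff.2 h
      have := res_app ψ hW (res M (preimage_imageOpens f V).le x)
      exact (res_res N _ _ _).trans (this.symm.trans
        (congrArg (ψ.app W) (res_res M (preimage_imageOpens f V).le (f.preimage_mono hW) x)))
    refine ⟨homMk χ (fun {V V'} h x => ?_) (fun V r x => ?_), modules_hom_ext fun U x => ?_⟩
    · have h1 := hχ V (imageOpens f V') ((preimage_imageOpens f V').le.trans h) x
      have h2 := hχ V' (imageOpens f V') (preimage_imageOpens f V').le (res M h x)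
      rw [res_res, ← h1] at h2
      have h3 := congrArg (res N (preimage_imageOpens f V').ge) h2
      rwa [res_res, res_res, res_self] at h3
    · refine eq_of_locally_eq N fun y hy => ?_
      obtain ⟨W, hW, hyW, s, hs⟩ := hf.exists_lift (imageOpens f V)
        (resO (preimage_imageOpens f V).le r) (f y)
        (f.isClosedEmbedding.isInducing.mem_functorObj_iff _ |>.2 hy)
      have hWV : f ⁻¹ᵁ W ≤ V := preimage_le_of_le_imageOpens hW
      refine ⟨f ⁻¹ᵁ W, hWV, hyW, ?_⟩
      rw [resO_resO] at hs
      rw [res_smul, hχ, hχ, res_smul, ← hs]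
      exact ψ.app_smul s _
    · have := hχ (f ⁻¹ᵁ U) U le_rfl x
      rw [res_self] at this
      exact this.trans (congrArg (ψ.app U) (res_self M le_rfl x))

theorem smul_eq_zero (hf : IsLocallyCutOut f a) {N : Z.Modules} (hN : (mulEnd a).app N = 0)
    {W : Z.Opens} {s : Γ(Z, W)} (hs : f.app W s = 0) (x : Γ(N, W)) : s • x = 0 := by
  refine eq_of_locally_eq N fun z hz => ?_
  obtain ⟨W', h, hz', c, hc⟩ := hf.exists_dvd W s hs z hz
  refine ⟨W', h, hz', ?_⟩
  rw [res_smul, hc, mul_smul, map_zero, ← mulEnd_app_app, hN]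
  rfl

theorem smul_eq_smul (hf : IsLocallyCutOut f a) {N : Z.Modules} (hN : (mulEnd a).app N = 0)
    {W : Z.Opens} {s s' : Γ(Z, W)} (hs : f.app W s = f.app W s') (x : Γ(N, W)) : s • x = s' • x := by
  rw [← sub_eq_zero, ← sub_smul]
  exact hf.smul_eq_zero hN (by rw [map_sub, hs, sub_self]) x

/-- The product `r x` is glued from `s • x` over the opens where `r` lifts to `s`. Two lifts differ
locally by a multiple of `a`, which kills `N`, so the pieces agree. -/
theorem exists_act (hf : IsLocallyCutOut f a) {N : Z.Modules} (hN : (mulEnd a).app N = 0)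
    {V : Y.Opens} (r : Γ(Y, V)) (x : Γ(N, imageOpens f V)) :
    ∃ y : Γ(N, imageOpens f V), ∀ (W : Z.Opens) (h : W ≤ imageOpens f V) (s : Γ(Z, W)),
      f.app W s = resO (preimage_le_of_le_imageOpens h) r → res N h y = s • res N h x := by
  let ι := { p : Σ W : Z.Opens, Γ(Z, W) // ∃ h : p.1 ≤ imageOpens f V,
    f.app p.1 p.2 = resO (preimage_le_of_le_imageOpens h) r }
  obtain ⟨y, hy⟩ := exists_gluing N (ι := ι) (fun p => p.1.1) (fun p => p.2.1) (fun z hz => by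
      obtain ⟨W, hW, hzW, s, hs⟩ := hf.exists_lift (imageOpens f V)
        (resO (preimage_imageOpens f V).le r) z hz
      rw [resO_resO] at hs
      exact ⟨⟨⟨W, s⟩, hW, hs⟩, hzW⟩)
    (fun p => p.1.2 • res N p.2.1 x) (fun p q W hp hq => by
      rw [res_smul, res_smul, res_res, res_res]
      refine hf.smul_eq_smul hN ?_ _
      rw [app_resO, app_resO, p.2.2, q.2.2, resO_resO, resO_resO])
  exact ⟨y, fun W h s hs => hy ⟨⟨W, s⟩, h, hs⟩⟩

/-- The scalar action of sections of `𝒪_Y` on an `𝒪_Z`-module killed by `a`. -/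
noncomputable def act (hf : IsLocallyCutOut f a) {N : Z.Modules} (hN : (mulEnd a).app N = 0)
    {V : Y.Opens} (r : Γ(Y, V)) (x : Γ(N, imageOpens f V)) : Γ(N, imageOpens f V) :=
  (hf.exists_act hN r x).choose

theorem res_act (hf : IsLocallyCutOut f a) {N : Z.Modules} (hN : (mulEnd a).app N = 0)
    {V : Y.Opens} (r : Γ(Y, V)) (x : Γ(N, imageOpens f V)) {W : Z.Opens}
    (h : W ≤ imageOpens f V) (s : Γ(Z, W))
    (hs : f.app W s = resO (preimage_le_of_le_imageOpens h) r) :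
    res N h (hf.act hN r x) = s • res N h x :=
  (hf.exists_act hN r x).choose_spec W h s hs

/-- Two scalars are lifted at once so that the module axioms can be checked where `act` is honest
scalar multiplication. -/
theorem eq_of_forall_lift₂ (hf : IsLocallyCutOut f a) {N : Z.Modules} {V : Y.Opens} (r r' : Γ(Y, V))
    {x y : Γ(N, imageOpens f V)}
    (H : ∀ (W : Z.Opens) (h : W ≤ imageOpens f V) (s s' : Γ(Z, W)),
      f.app W s = resO (preimage_le_of_le_imageOpens h) r →
      f.app W s' = resO (preimage_le_of_le_imageOpens h) r' → res N h x = res N h y) : x = y := by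
  refine eq_of_locally_eq N fun z hz => ?_
  obtain ⟨W, hW, hzW, s, hs⟩ := hf.exists_lift (imageOpens f V)
    (resO (preimage_imageOpens f V).le r) z hz
  obtain ⟨W', hW', hzW', s', hs'⟩ := hf.exists_lift (imageOpens f V)
    (resO (preimage_imageOpens f V).le r') z hz
  rw [resO_resO] at hs hs'
  refine ⟨W ⊓ W', inf_le_left.trans hW, ⟨hzW, hzW'⟩,
    H _ _ (resO inf_le_left s) (resO inf_le_right s') ?_ ?_⟩
  · rw [app_resO, hs, resO_resO]
  · rw [app_resO, hs', resO_resO]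

/-- A module killed by `a`, as a module over `𝒪_Y`. -/
noncomputable abbrev moduleSections (hf : IsLocallyCutOut f a) {N : Z.Modules}
    (hN : (mulEnd a).app N = 0) (V : Y.Opens) : Module Γ(Y, V) Γ(N, imageOpens f V) :=
  letI : SMul Γ(Y, V) Γ(N, imageOpens f V) := ⟨hf.act hN⟩
  Module.ofMinimalAxioms
    (fun r x y => hf.eq_of_forall_lift₂ r r fun W h s s' hs hs' => by
      change res N h (hf.act hN r (x + y)) = res N h (hf.act hN r x + hf.act hN r y)
      rw [map_add, hf.res_act hN r _ h s hs, hf.res_act hN r _ h s hs, hf.res_act hN r _ h s hs,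
        map_add, smul_add])
    (fun r r' x => hf.eq_of_forall_lift₂ r r' fun W h s s' hs hs' => by
      change res N h (hf.act hN (r + r') x) = res N h (hf.act hN r x + hf.act hN r' x)
      rw [map_add, hf.res_act hN (r + r') _ h (s + s') (by rw [map_add, map_add, hs, hs']),
        hf.res_act hN r _ h s hs, hf.res_act hN r' _ h s' hs', add_smul])
    (fun r r' x => hf.eq_of_forall_lift₂ r r' fun W h s s' hs hs' => by
      change res N h (hf.act hN (r * r') x) = res N h (hf.act hN r (hf.act hN r' x))
      rw [hf.res_act hN (r * r') _ h (s * s') (by rw [map_mul, map_mul, hs, hs']),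
        hf.res_act hN r _ h s hs, hf.res_act hN r' _ h s' hs', mul_smul])
    (fun x => hf.eq_of_forall_lift₂ 1 1 fun W h s s' hs hs' => by
      change res N h (hf.act hN 1 x) = res N h x
      rw [hf.res_act hN 1 _ h 1 (by rw [map_one, map_one]), one_smul])

theorem res_act_of_le (hf : IsLocallyCutOut f a) {N : Z.Modules} (hN : (mulEnd a).app N = 0)
    {V V' : Y.Opens} (hV : V' ≤ V) (r : Γ(Y, V)) (x : Γ(N, imageOpens f V)) :
    res N (imageOpens_mono f hV) (hf.act hN r x) =
      hf.act hN (resO hV r) (res N (imageOpens_mono f hV) x) :=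
  hf.eq_of_forall_lift₂ (resO hV r) (resO hV r) fun W h s s' hs hs' => by
    rw [hf.res_act hN (resO hV r) _ h s hs, res_res, res_res,
      hf.res_act hN r _ (h.trans (imageOpens_mono f hV)) s (by rw [hs, resO_resO])]

/-- The functor `imageOpens`. -/
def imageOpensFunctor (f : Y ⟶ Z) [IsClosedImmersion f] : Y.Opens ⥤ Z.Opens where
  obj := imageOpens f
  map i := homOfLE (imageOpens_mono f i.le)

/-- A surjective closed immersion is a homeomorphism, and this presheaf is the pushforward of `N`
along its inverse. -/
theorem isSheaf_imageOpens (hf : IsLocallyCutOut f a) (N : Z.Modules) :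
    TopCat.Presheaf.IsSheaf ((imageOpensFunctor f).op ⋙ N.presheaf) := by
  let e := (Equiv.ofBijective f ⟨f.isClosedEmbedding.injective, hf.surjective⟩).toHomeomorphOfIsInducing
    f.isClosedEmbedding.isInducing
  let h : (Z : TopCat) ⟶ (Y : TopCat) := TopCat.ofHom ⟨e.symm, e.symm.continuous⟩
  have hV (V : Y.Opens) : (TopologicalSpace.Opens.map h).obj V = imageOpens f V := by
    ext z
    obtain ⟨y, rfl⟩ := hf.surjective z
    refine Iff.trans ?_ (f.isClosedEmbedding.isInducing.mem_functorObj_iff V).symm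
    change e.symm (e y) ∈ V ↔ _
    rw [e.symm_apply_apply]
  let i : TopologicalSpace.Opens.map h ≅ imageOpensFunctor f :=
    NatIso.ofComponents fun V => eqToIso (hV V)
  exact TopCat.Presheaf.isSheaf_of_iso (Functor.isoWhiskerRight (NatIso.op i) N.presheaf).symm
    (TopCat.Sheaf.pushforward_sheaf_of_sheaf h N.isSheaf)

/-- A module killed by `a`, as an `𝒪_Y`-module. -/
noncomputable def descend (hf : IsLocallyCutOut f a) {N : Z.Modules} (hN : (mulEnd a).app N = 0) :
    Y.Modules :=
  letI (V : Y.Opensᵒᵖ) : Module (Y.ringCatSheaf.obj.obj V)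
      (((imageOpensFunctor f).op ⋙ N.presheaf).obj V) := hf.moduleSections hN V.unop
  SheafOfModules.mk (R := Y.ringCatSheaf)
    (PresheafOfModules.ofPresheaf ((imageOpensFunctor f).op ⋙ N.presheaf)
      fun {_ _} i r x => hf.res_act_of_le hN i.unop.le r x)
    (hf.isSheaf_imageOpens N)

theorem mem_essImage (hf : IsLocallyCutOut f a) (N : Z.Modules) (hN : (mulEnd a).app N = 0) :
    (Scheme.Modules.pushforward f).essImage N := by
  let M := (Scheme.Modules.pushforward f).obj (hf.descend hN)
  let α (U : Z.Opens) : Γ(M, U) →+ Γ(N, U) := res N (le_imageOpens_preimage U)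
  let β (U : Z.Opens) : Γ(N, U) →+ Γ(M, U) := res N (imageOpens_preimage_le hf.surjective U)
  have hα (U : Z.Opens) (s : Γ(Z, U)) (x : Γ(M, U)) : α U (s • x) = s • α U x :=
    hf.res_act hN (f.app U s) x (le_imageOpens_preimage U) s (resO_self _ _).symm
  have hαβ (U : Z.Opens) (x : Γ(N, U)) : α U (β U x) = x :=
    (res_res N _ _ _).trans (res_self N _ _)
  have hβα (U : Z.Opens) (x : Γ(M, U)) : β U (α U x) = x :=
    (res_res N _ _ _).trans (res_self N _ _)
  refine ⟨hf.descend hN, ⟨⟨homMk α (fun h x => ?_) hα, homMk β (fun h x => ?_) fun U s x => ?_,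
    modules_hom_ext hβα, modules_hom_ext hαβ⟩⟩⟩
  · exact (res_res N _ _ _).trans (res_res N _ _ _).symm
  · exact (res_res N _ _ _).trans (res_res N _ _ _).symm
  · rw [← hβα U (s • β U x), hα, hαβ]

theorem mulEnd_pushforward (hf : IsLocallyCutOut f a) (M : Y.Modules) :
    (mulEnd a).app ((Scheme.Modules.pushforward f).obj M) = 0 :=
  modules_hom_ext fun U x => by
    rw [mulEnd_app_app, pushforward_smul, app_resO, hf.app_eq_zero, map_zero]
    exact zero_smul _ (show Γ(M, f ⁻¹ᵁ U) from x)

theorem pushforward_faithful (_ : IsLocallyCutOut f a) : (Scheme.Modules.pushforward f).Faithful where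
  map_injective {M N φ ψ} h := modules_hom_ext fun V x => by
    have := hom_app_congr h (imageOpens f V) (res M (preimage_imageOpens f V).le x)
    change φ.app (f ⁻¹ᵁ imageOpens f V) _ = ψ.app (f ⁻¹ᵁ imageOpens f V) _ at this
    rw [res_app, res_app] at this
    have h2 := congrArg (res N (preimage_imageOpens f V).ge) this
    rwa [res_res, res_res, res_self, res_self] at h2

end IsLocallyCutOut

end Thickening

/-! ### Exactness of multiplications on flat modules -/

section Flat

/-- If the annihilator of `a` lies in `(b)`, the same holds in every flat module. -/
theorem exists_smul_eq_of_smul_eq_zero {R M : Type*} [CommRing R] [AddCommGroup M] [Module R M]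
    [Module.Flat R M] {a b : R} (hab : ∀ r, a * r = 0 → ∃ s, r = b * s) {x : M} (hx : a • x = 0) :
    ∃ y : M, x = b • y := by
  -- Equational criterion: `a x = 0` is a trivial relation, so `x = ∑ c j • y j` with every `c j`
  -- annihilated by `a`, hence divisible by `b`.
  obtain ⟨k, c, y, hc, h0⟩ := Module.Flat.isTrivialRelation_of_sum_smul_eq_zero (R := R)
    (f := fun _ : Unit => a) (x := fun _ => x) (by simpa using hx)
  have h (j : Fin k) : ∃ s, c () j = b * s := hab _ (by simpa using h0 j)
  choose s hs using h
  refine ⟨∑ j, s j • y j, ?_⟩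
  rw [Finset.smul_sum]
  refine (hc ()).trans ?_
  exact Finset.sum_congr rfl fun j _ => by rw [hs, mul_smul]

variable {Z : Scheme.{u}}

theorem germ_smul (M : Z.Modules) {U : Z.Opens} {z : Z} (hz : z ∈ U) (s : Γ(Z, U)) (x : Γ(M, U)) :
    TopCat.Presheaf.germ M.presheaf U z hz (s • x) =
      (Z.presheaf.germ U z hz s • (TopCat.Presheaf.germ M.presheaf U z hz x : stalk M z) :
        stalk M z) :=
  PresheafOfModules.germ_smul (R := Z.presheaf) M.val z U hz s x

theorem app_injective_of_mono {M N : Z.Modules} (φ : M ⟶ N) [Mono φ] (U : Z.Opens) :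
    Function.Injective (φ.app U) := by
  have : Mono ((Scheme.Modules.toPresheaf Z).map φ) := inferInstance
  have : Mono (((Scheme.Modules.toPresheaf Z).map φ).app (.op U)) := inferInstance
  exact (AddCommGrpCat.mono_iff_injective _).1 this

/-- A section killed by `a` is, by flatness of the stalk, divisible by `b` there, and this equality
of germs spreads to a neighbourhood. -/
theorem exact_mulEnd {P : Z.Modules} (hP : IsFlatModule P) {a b : Γ(Z, ⊤)} (h0 : b * a = 0)
    (hab : ∀ (z : Z) (r : Z.presheaf.stalk z), Z.presheaf.germ ⊤ z trivial a * r = 0 →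
      ∃ s, r = Z.presheaf.germ ⊤ z trivial b * s) :
    ∃ h : (mulEnd b).app P ≫ (mulEnd a).app P = 0,
      (ShortComplex.mk ((mulEnd b).app P) ((mulEnd a).app P) h).Exact := by
  have h : (mulEnd b).app P ≫ (mulEnd a).app P = 0 := modules_hom_ext fun U x => by
    change (resO le_top a : Γ(Z, U)) • (resO le_top b : Γ(Z, U)) • x = 0
    rw [smul_smul, ← map_mul, mul_comm, h0, map_zero, zero_smul]
  refine ⟨h, ?_⟩
  rw [ShortComplex.exact_iff_epi_kernel_lift, epi_iff_locallySurjective,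
    TopCat.Presheaf.isLocallySurjective_iff]
  intro U t z hz
  let K := kernel ((mulEnd a).app P)
  let ι : K ⟶ P := kernel.ι ((mulEnd a).app P)
  let k : Γ(P, U) := ι.app U t
  have hk : (resO le_top a : Γ(Z, U)) • k = 0 :=
    hom_app_congr (kernel.condition ((mulEnd a).app P)) U t
  have hg {V : Z.Opens} (hV : z ∈ V) (c : Γ(Z, ⊤)) :
      Z.presheaf.germ V z hV (resO le_top c) = Z.presheaf.germ ⊤ z trivial c :=
    TopCat.Presheaf.germ_res_apply _ _ _ _ _
  have := hP z
  obtain ⟨y, hy⟩ := exists_smul_eq_of_smul_eq_zero (hab z)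
    (x := (TopCat.Presheaf.germ P.presheaf U z hz k : stalk P z)) (by
      rw [← hg hz, ← germ_smul, hk, map_zero])
  obtain ⟨V, hV, y, rfl⟩ := TopCat.Presheaf.exists_germ_eq (C := AddCommGrpCat.{u}) P.presheaf y
  rw [← hg hV, ← germ_smul] at hy
  obtain ⟨W, hzW, iU, iV, hW⟩ := TopCat.Presheaf.germ_eq P.presheaf z hz hV _ _ hy
  refine ⟨W, iU.le, ⟨res P iV.le y, ?_⟩, hzW⟩
  refine app_injective_of_mono ι W ?_
  change _ = ι.app W (res K iU.le t)
  rw [res_app]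
  change res P iU.le k = res P iV.le (_ • y) at hW
  change _ = res P iU.le k
  rw [hW, res_smul, resO_resO]
  exact hom_app_congr (kernel.lift_ι ((mulEnd a).app P) ((mulEnd b).app P) h) W (res P iV.le y)

end Flat

/-! ### Base change from `Spec S`: annihilators and ideals of closed immersions -/

section BaseChange

/-- Flat ring homomorphisms preserve the inclusion of the annihilator of `a` in `(b)`. -/
theorem exists_eq_mul_of_flat {R R' : Type*} [CommRing R] [CommRing R'] {φ : R →+* R'}
    (hφ : φ.Flat) {a b : R} (hab : ∀ r, a * r = 0 → ∃ s, r = b * s) (r : R') (hr : φ a * r = 0) :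
    ∃ s, r = φ b * s := by
  algebraize [φ]
  obtain ⟨s, hs⟩ := exists_smul_eq_of_smul_eq_zero (R := R) (M := R') hab (x := r)
    (by rw [Algebra.smul_def]; exact hr)
  exact ⟨s, by rw [hs, Algebra.smul_def]; rfl⟩

variable {Y Z : Scheme.{u}} {S T : CommRingCat.{u}}

/-- The global section of a scheme over `Spec S` given by an element of `S`. -/
noncomputable def pullbackSection (q : Z ⟶ Spec S) (s : S) : Γ(Z, ⊤) :=
  q.appTop ((Scheme.ΓSpecIso S).inv s)

theorem pullbackSection_mul (q : Z ⟶ Spec S) (s t : S) :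
    pullbackSection q (s * t) = pullbackSection q s * pullbackSection q t := by
  simp [pullbackSection]

theorem exists_affine_le {U : Z.Opens} {z : Z} (hz : z ∈ U) :
    ∃ W : Z.Opens, IsAffineOpen W ∧ z ∈ W ∧ W ≤ U := by
  obtain ⟨_, ⟨W, hW, rfl⟩, hzW, hWU⟩ := Z.isBasis_affineOpens.exists_subset_of_mem_open hz U.isOpen
  exact ⟨W, hW, hzW, hWU⟩

/-- The map from `S` to the stalk is a composite of flat maps through `Γ(Spec S, ⊤)` and an affine
neighbourhood, and flat maps preserve the annihilator condition. -/
theorem germ_pullbackSection_exact (q : Z ⟶ Spec S) [Flat q] {a b : S}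
    (hab : ∀ r, a * r = 0 → ∃ s, r = b * s) (z : Z) (r : Z.presheaf.stalk z)
    (hr : Z.presheaf.germ ⊤ z trivial (pullbackSection q a) * r = 0) :
    ∃ s, r = Z.presheaf.germ ⊤ z trivial (pullbackSection q b) * s := by
  obtain ⟨W, hW, hzW, -⟩ := exists_affine_le (U := ⊤) (z := z) trivial
  have hg (c : S) : Z.presheaf.germ ⊤ z trivial (pullbackSection q c) =
      Z.presheaf.germ W z hzW (q.appLE ⊤ W le_top ((Scheme.ΓSpecIso S).inv c)) :=
    (TopCat.Presheaf.germ_res_apply Z.presheaf (homOfLE le_top) z hzW (pullbackSection q c)).symm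
  have h₁ := exists_eq_mul_of_flat (φ := (Scheme.ΓSpecIso S).inv.hom)
    (.of_bijective (ConcreteCategory.bijective_of_isIso (Scheme.ΓSpecIso S).inv)) hab
  have h₂ := exists_eq_mul_of_flat (q.flat_appLE (isAffineOpen_top _) hW le_top) h₁
  have h₃ : (Z.presheaf.germ W z hzW).hom.Flat := by
    algebraize [(Z.presheaf.germ W z hzW).hom]
    have : IsLocalization.AtPrime (Z.presheaf.stalk z) (hW.primeIdealOf ⟨z, hzW⟩).asIdeal :=
      hW.isLocalization_stalk ⟨z, hzW⟩
    exact IsLocalization.flat (Z.presheaf.stalk z) (hW.primeIdealOf ⟨z, hzW⟩).asIdeal.primeCompl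
  rw [hg] at hr ⊢
  exact exists_eq_mul_of_flat h₃ h₂ r hr

theorem isLocallyCutOut_of_isPullback {f : Y ⟶ Z} [IsClosedImmersion f] {qY : Y ⟶ Spec T}
    {qZ : Z ⟶ Spec S} {φ : S ⟶ T} (H : IsPullback f qY qZ (Spec.map φ))
    (hφ : Function.Surjective φ) {a : S} (ha : RingHom.ker φ.hom = Ideal.span {a})
    (hn : IsNilpotent a) : IsLocallyCutOut f (pullbackSection qZ a) where
  surjective := by
    -- The kernel generator is nilpotent, so it lies in every prime; surjectivity then passes to the
    -- base change.
    have h1 : Surjective (Spec.map φ) := ⟨by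
      rw [← Set.range_eq_univ]
      refine (range_comap_of_surjective _ φ.hom hφ).trans ?_
      refine Set.eq_univ_of_forall fun x => ?_
      rw [ha]
      obtain ⟨n, hn⟩ := hn
      refine (PrimeSpectrum.mem_zeroLocus _ _).2 ((Ideal.span_singleton_le_iff_mem _).2 ?_)
      exact x.isPrime.mem_of_pow_mem n (by rw [hn]; exact zero_mem _)⟩
    have h2 : Surjective f := MorphismProperty.of_isPullback H.flip h1
    exact h2.surj
  app_eq_zero := by
    have h0 : φ.hom a = 0 := by
      rw [← RingHom.mem_ker, ha]; exact Ideal.mem_span_singleton_self a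
    have h1 : (Spec.map φ).appTop ((Scheme.ΓSpecIso S).inv a) = (Scheme.ΓSpecIso T).inv (φ a) :=
      (ConcreteCategory.congr_hom (Scheme.ΓSpecIso_inv_naturality φ) a).symm
    have h2 := congrArg (fun g : Y ⟶ Spec S => g.appTop ((Scheme.ΓSpecIso S).inv a)) H.w
    simp only [Scheme.Hom.comp_appTop, CommRingCat.comp_apply] at h2
    refine h2.trans ?_
    rw [h1]
    change qY.appTop ((Scheme.ΓSpecIso T).inv (φ.hom a)) = 0
    rw [h0, map_zero, map_zero]
  exists_lift U r z hz := by
    obtain ⟨W, hW, hzW, hWU⟩ := exists_affine_le hz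
    exact ⟨W, hWU, hzW, f.app_surjective W hW _⟩
  exists_dvd U s hs z hz := by
    obtain ⟨W, hW, hzW, hWU⟩ := exists_affine_le hz
    refine ⟨W, hWU, hzW, ?_⟩
    have hs' : f.app W (resO hWU s) = 0 := by rw [app_resO, hs, map_zero]
    -- Over the affine `W`, the sections of `Y` are the pushout of `Γ(Z, W)` and `T` over `S`. The
    -- quotient of `Γ(Z, W)` by `a` receives compatible maps from both, so a section that vanishes
    -- on `Y` vanishes modulo `a`.
    let I : Ideal Γ(Z, W) := Ideal.span {resO le_top (pullbackSection qZ a)}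
    let χ : S →+* Γ(Z, W) := (qZ.appLE ⊤ W le_top).hom.comp (Scheme.ΓSpecIso S).inv.hom
    let l : T →+* Γ(Z, W) ⧸ I := RingHom.liftOfSurjective φ.hom hφ
      ⟨(Ideal.Quotient.mk I).comp χ, by
        rw [ha, Ideal.span_singleton_le_iff_mem, RingHom.mem_ker]
        exact Ideal.Quotient.eq_zero_iff_mem.2 (Ideal.mem_span_singleton_self _)⟩
    have hl (x : S) : l (φ.hom x) = Ideal.Quotient.mk I (χ x) :=
      RingHom.liftOfRightInverse_comp_apply _ _ _ _ x
    have hUY : f ⁻¹ᵁ W = f ⁻¹ᵁ W ⊓ qY ⁻¹ᵁ ⊤ := by simp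
    have hpo := (isIso_pushoutSection_iff H (US := ⊤) (UT := ⊤) le_top le_top hUY).1
      (isIso_pushoutSection_of_isAffineOpen H le_top le_top hUY (isAffineOpen_top _)
        (isAffineOpen_top _) hW)
    let d := hpo.desc (CommRingCat.ofHom (Ideal.Quotient.mk I))
      ((Scheme.ΓSpecIso T).hom ≫ CommRingCat.ofHom l) (by
        rw [← cancel_epi (Scheme.ΓSpecIso S).inv]
        ext x
        change Ideal.Quotient.mk I (χ x) = l ((Scheme.ΓSpecIso T).hom
          ((Spec.map φ).appLE ⊤ ⊤ le_top ((Scheme.ΓSpecIso S).inv x)))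
        rw [← hl]
        congr 1
        have h1 : (Spec.map φ).appLE ⊤ ⊤ le_top ((Scheme.ΓSpecIso S).inv x) =
            (Scheme.ΓSpecIso T).inv (φ x) := by
          refine (congrArg (fun g : Γ(Spec S, ⊤) ⟶ Γ(Spec T, ⊤) => g ((Scheme.ΓSpecIso S).inv x))
            (Scheme.Hom.appLE_eq_app (f := Spec.map φ) (U := ⊤))).trans ?_
          exact (ConcreteCategory.congr_hom (Scheme.ΓSpecIso_inv_naturality φ) x).symm
        rw [h1]
        simp)
    have hd : d (f.app W (resO hWU s)) = Ideal.Quotient.mk I (resO hWU s) := by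
      rw [← Scheme.Hom.appLE_eq_app]
      exact ConcreteCategory.congr_hom (hpo.inl_desc _ _ _) (resO hWU s)
    rw [hs', map_zero] at hd
    obtain ⟨c, hc⟩ := Ideal.mem_span_singleton'.1 (Ideal.Quotient.eq_zero_iff_mem.1 hd.symm)
    exact ⟨c, by rw [← hc, mul_comm]⟩

end BaseChange

/-! ### Powers of the uniformiser and the thickenings -/

section Uniformizer

variable {k : Type u} [Field k] {X : Scheme.{u}} (p : X ⟶ Spec (.of k))
  {R : Type u} [CommRing R] [Algebra k R] (π : R)

theorem isPullback_thickeningι {m' m : ℕ} (h : m' ≤ m) :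
    IsPullback (thickeningι p π h) (pullback.snd _ _) (pullback.snd _ _)
      (Spec.map (CommRingCat.ofHom (quotientMap (k := k) π h).toRingHom)) := by
  refine IsPullback.of_right (h₁₂ := pullback.fst _ _) (v₁₃ := p)
    (h₂₂ := Spec.map (CommRingCat.ofHom (algebraMap k (R ⧸ Ideal.span {π ^ m})))) ?_ ?_
    (IsPullback.of_hasPullback _ _)
  · have h1 : thickeningι p π h ≫ pullback.fst _ _ = pullback.fst _ _ :=
      (pullback.lift_fst _ _ _).trans (Category.comp_id _)
    have h2 : Spec.map (CommRingCat.ofHom (quotientMap (k := k) π h).toRingHom) ≫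
        Spec.map (CommRingCat.ofHom (algebraMap k (R ⧸ Ideal.span {π ^ m}))) =
        Spec.map (CommRingCat.ofHom (algebraMap k (R ⧸ Ideal.span {π ^ m'}))) := by
      rw [← Spec.map_comp, ← CommRingCat.ofHom_comp]
      congr 2
    rw [h1, h2]
    exact IsPullback.of_hasPullback _ _
  · exact pullback.lift_snd _ _ _

theorem ker_quotientMap {m' m : ℕ} (h : m' ≤ m) :
    RingHom.ker (quotientMap (k := k) π h).toRingHom =
      Ideal.span {Ideal.Quotient.mk (Ideal.span {π ^ m}) (π ^ m')} := by
  ext x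
  obtain ⟨x, rfl⟩ := Ideal.Quotient.mk_surjective x
  rw [RingHom.mem_ker]
  change Ideal.Quotient.mk (Ideal.span {π ^ m'}) x = 0 ↔ _
  rw [Ideal.Quotient.eq_zero_iff_mem, Ideal.mem_span_singleton, Ideal.mem_span_singleton]
  refine ⟨fun h => map_dvd _ h, fun ⟨c, hc⟩ => ?_⟩
  obtain ⟨c, rfl⟩ := Ideal.Quotient.mk_surjective c
  rw [← map_mul, Ideal.Quotient.eq, Ideal.mem_span_singleton] at hc
  exact (dvd_sub_left (dvd_mul_right _ _)).1 ((pow_dvd_pow π h).trans hc)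

theorem exists_eq_mul_of_pow_mul_eq_zero [IsDomain R] (hπ : π ≠ 0) {i j m : ℕ} (h : i + j = m)
    (r : R ⧸ Ideal.span {π ^ m}) (hr : Ideal.Quotient.mk _ (π ^ i) * r = 0) :
    ∃ s, r = Ideal.Quotient.mk _ (π ^ j) * s := by
  obtain ⟨r, rfl⟩ := Ideal.Quotient.mk_surjective r
  rw [← map_mul, Ideal.Quotient.eq_zero_iff_mem, Ideal.mem_span_singleton] at hr
  obtain ⟨c, hc⟩ := hr
  refine ⟨Ideal.Quotient.mk _ c, ?_⟩
  rw [← map_mul]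
  congr 1
  apply mul_left_cancel₀ (pow_ne_zero i hπ)
  rw [hc, ← h, pow_add, mul_assoc]

end Uniformizer

/-! ### Assembly for schemes -/

section Main

/-- Modules that receive no nonzero morphism from `Coh_{≤ d}`. -/
def TorsionFree (Y : Scheme.{u}) (d : ℕ) : ObjectProperty Y.Modules := fun M =>
  ∀ T, CohLE d T → ∀ g : T ⟶ M, g = 0

/-- The left orthogonal of `TorsionFree`. -/
def Torsion (Y : Scheme.{u}) (d : ℕ) : ObjectProperty Y.Modules := fun T =>
  ∀ M, TorsionFree Y d M → ∀ g : T ⟶ M, g = 0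

instance (Y : Scheme.{u}) (d : ℕ) : (TorsionFree Y d).IsClosedUnderIsomorphisms where
  of_iso e h T hT g := by
    rw [← cancel_mono e.inv, zero_comp]
    exact h T hT _

instance (Y : Scheme.{u}) (d : ℕ) : (Torsion Y d).IsClosedUnderIsomorphisms where
  of_iso e h M hM g := by
    rw [← cancel_epi e.hom, comp_zero]
    exact h M hM _

variable {Y : Scheme.{u}} [HasDerivedCategory.{w} Y.Modules]

/-- Coherence is dropped because the argument uses only orthogonality, and both orthogonal classes
are invariant under isomorphism for formal reasons. -/
theorem tiltLE.toTiltLE {n : ℤ} {E : DerivedCategory Y.Modules} (h : tiltLE n E) :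
    TiltLE (Torsion Y 1) n E :=
  ⟨(DerivedCategory.isLE_iff _ _).2 h.2.1, fun _ hM g => hM _ h.2.2 g⟩

theorem tiltGE.toTiltGE {n : ℤ} {E : DerivedCategory Y.Modules} (h : tiltGE n E) :
    TiltGE (TorsionFree Y 1) n E :=
  ⟨(DerivedCategory.isGE_iff _ _).2 h.2.1, h.2.2.2⟩

variable {Z : Scheme.{u}} [HasDerivedCategory.{w'} Z.Modules]

/-- The same flat complex represents the pushforward of `A` and, after pullback, `E`. This puts `G
A` in the middle of both triangles. -/
theorem nonempty_iso_of_isLocallyCutOut {f : Y ⟶ Z} [IsClosedImmersion f] {a b : Γ(Z, ⊤)}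
    (hf : IsLocallyCutOut f a) (h0 : a * b = 0)
    (hab : ∀ (z : Z) (r : Z.presheaf.stalk z), Z.presheaf.germ ⊤ z trivial a * r = 0 →
      ∃ s, r = Z.presheaf.germ ⊤ z trivial b * s)
    (hba : ∀ (z : Z) (r : Z.presheaf.stalk z), Z.presheaf.germ ⊤ z trivial b * r = 0 →
      ∃ s, r = Z.presheaf.germ ⊤ z trivial a * s)
    {A E : DerivedCategory Y.Modules} (hA : heart A)
    (hE : IsDerivedPullback f ((derivedPushforward f).obj A) E) {i j : ℤ} (r : ℕ)
    (hij : i + 2 * r = j) (hj : j < 0) {B C : DerivedCategory Y.Modules}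
    (hB : IsHeartCohomology i E B) (hC : IsHeartCohomology j E C) : Nonempty (B ≅ C) := by
  obtain ⟨P, -, hP, ⟨eP⟩, ⟨eE⟩⟩ := hE
  have := hf.pushforward_full
  have := hf.pushforward_faithful
  obtain ⟨J, hJ₁, hJ₂⟩ := exists_hasTriangle_of_adjunction
    (Scheme.Modules.pullbackPushforwardAdjunction f) hf.mulEnd_pushforward hf.mem_essImage P
    (fun n => exact_mulEnd (hP n) h0 hba) (fun n => exact_mulEnd (hP n) (by rwa [mul_comm]) hab) eE
  obtain ⟨hB₀, X, ⟨hX, V, hV, _, _, _, hXV⟩, hBX, W, hW, _, _, _, hWX⟩ := hB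
  obtain ⟨hC₀, X', ⟨hX', V', hV', _, _, _, hXV'⟩, hCX, W', hW', _, _, _, hWX'⟩ := hC
  exact nonempty_iso_of_periodicity hf.mulEnd_pushforward hf.mem_essImage
    (fun _ _ hT hM g => hT _ hM g) hA.2.toTiltGE eP hJ₁ hJ₂ r hij hj
    hX.toTiltLE hV.toTiltGE ⟨_, _, _, hXV⟩ hW.toTiltLE hBX.toTiltGE ⟨_, _, _, hWX⟩
    hX'.toTiltLE hV'.toTiltGE ⟨_, _, _, hXV'⟩ hW'.toTiltLE hCX.toTiltGE ⟨_, _, _, hWX'⟩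
    hB₀.1.toTiltLE hB₀.2.toTiltGE hC₀.1.toTiltLE hC₀.2.toTiltGE

end Main

end CoherentTilt

theorem lemma5p8 {k : Type u} [Field k] [IsAlgClosed k] [CharZero k]
    {X : Scheme.{u}} (p : X ⟶ Spec (.of k)) [SmoothOfRelativeDimension 3 p]
    (_ : CoherentTilt.IsProjectiveOver p)
    {R : Type u} [CommRing R] [IsDomain R] [IsDiscreteValuationRing R] [Algebra k R]
    (π : R) (_ : Irreducible π)
    (m' m : ℕ) (_ : 1 ≤ m') (hm : m' < m)
    [HasDerivedCategory.{w} (CoherentTilt.thickening p π m).Modules]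
    [HasDerivedCategory.{w'} (CoherentTilt.thickening p π m').Modules]
    (A : DerivedCategory (CoherentTilt.thickening p π m').Modules) (_ : CoherentTilt.heart A)
    (E : DerivedCategory (CoherentTilt.thickening p π m').Modules)
    (_ : CoherentTilt.IsDerivedPullback (CoherentTilt.thickeningι p π hm.le)
      ((CoherentTilt.derivedPushforward (CoherentTilt.thickeningι p π hm.le)).obj A) E)
    (i j : ℤ) (_ : i < 0) (_ : Odd i) (_ : j < 0) (_ : Odd j)
    (B C : DerivedCategory (CoherentTilt.thickening p π m').Modules)
    (_ : CoherentTilt.IsHeartCohomology i E B) (_ : CoherentTilt.IsHeartCohomology j E C) :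
    Nonempty (B ≅ C) := by
  rename_i hπ hm' _ _ hA hE hi hi' hj hj' hB hC
  let q : CoherentTilt.thickening p π m ⟶ Spec (.of (R ⧸ Ideal.span {π ^ m})) :=
    pullback.snd _ _
  let σ (n : ℕ) : CommRingCat.of (R ⧸ Ideal.span {π ^ m}) :=
    Ideal.Quotient.mk (Ideal.span {π ^ m}) (π ^ n)
  have hσ : σ m' * σ (m - m') = 0 := by
    change Ideal.Quotient.mk _ (π ^ m') * Ideal.Quotient.mk _ (π ^ (m - m')) = 0
    rw [← map_mul, ← pow_add, Nat.add_sub_cancel' hm.le]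
    exact Ideal.Quotient.eq_zero_iff_mem.2 (Ideal.mem_span_singleton_self _)
  have hn : IsNilpotent (σ m') := by
    refine ⟨m, ?_⟩
    change Ideal.Quotient.mk _ (π ^ m') ^ m = 0
    rw [← map_pow, ← pow_mul]
    exact Ideal.Quotient.eq_zero_iff_mem.2
      (Ideal.mem_span_singleton.2 (pow_dvd_pow π (Nat.le_mul_of_pos_left m hm')))
  have hf := CoherentTilt.isLocallyCutOut_of_isPullback
    (CoherentTilt.isPullback_thickeningι p π hm.le)
    (Ideal.Quotient.factor_surjective
      (Ideal.span_singleton_le_span_singleton.mpr (pow_dvd_pow π hm.le)))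
    (CoherentTilt.ker_quotientMap (k := k) π hm.le) hn
  have h0 : CoherentTilt.pullbackSection q (σ m') *
      CoherentTilt.pullbackSection q (σ (m - m')) = 0 := by
    rw [← CoherentTilt.pullbackSection_mul, hσ, CoherentTilt.pullbackSection, map_zero, map_zero]
  -- The statement is symmetric, so one may take `i ≤ j`; equal parity makes `j - i` a multiple of
  -- the period two.
  have main {i j : ℤ} (hi' : Odd i) (hj : j < 0) (hj' : Odd j) (hij : i ≤ j)
      {B C : DerivedCategory (CoherentTilt.thickening p π m').Modules}
      (hB : CoherentTilt.IsHeartCohomology i E B) (hC : CoherentTilt.IsHeartCohomology j E C) :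
      Nonempty (B ≅ C) := by
    obtain ⟨r, hr⟩ : ∃ r : ℕ, i + 2 * r = j := by
      obtain ⟨c, rfl⟩ := hi'
      obtain ⟨d, rfl⟩ := hj'
      exact ⟨(d - c).toNat, by lia⟩
    exact CoherentTilt.nonempty_iso_of_isLocallyCutOut hf h0
      (CoherentTilt.germ_pullbackSection_exact q
        (CoherentTilt.exists_eq_mul_of_pow_mul_eq_zero π hπ.ne_zero (by lia)))
      (CoherentTilt.germ_pullbackSection_exact q
        (CoherentTilt.exists_eq_mul_of_pow_mul_eq_zero π hπ.ne_zero (by lia)))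
      hA hE r hr hj hB hC
  obtain h | h := le_total i j
  · exact main hi' hj hj' h hB hC
  · exact (main hj' hi hi' h hC hB).map Iso.symm
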